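/- \textbf{Theorem (Correspondences of loci, Presburger).} Fix a real number $q>1$. A \emph{Presburger set} is a subset of some $\mathbb{Z}^k$, $k\ge 0$, which is a Boolean combination of sets of the forms $\{x\in\mathbb{Z}^k\mid f(x)\ge 0\}$ and $\{x\in\mathbb{Z}^k\mid g(x)\equiv 0 \bmod n\}$, where $f,g$ are polynomials over $\mathbb{Z}$ of degree $\le 1$ and $n>0$ is an integer. A \emph{Presburger function} is a function between Presburger sets whose graph is a Presburger set. Put $$\mathbb{A}_q=\mathbb{Z}\Big[q,q^{-1},\Big(\tfrac{1}{1-q^{-i}}\Big)_{i\in\mathbb{Z},\ i>0}\Big]\subset\mathbb{R},$$ and, for a Presburger set $S$, let $\mathcal{P}_q(S)$ be the $\mathbb{A}_q$-algebra of $\mathbb{A}_q$-valued functions on $S$ generated by all Presburger functions $\alpha:S\to\mathbb{Z}$ and all functions $s\mapsto q^{\beta(s)}$ with $\beta:S\to\mathbb{Z}$ a Presburger function. For $h\in\mathcal{P}_q(S)$ let $Z(h)=\{s\in S\mid h(s)=0\}$, and for $f\in\mathcal{P}_q(S\times\mathbb{Z}^m)$ let $$\mathrm{Int}(f,S)=\{s\in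 S\mid f(s,\cdot)\text{ is integrable for the counting measure on }\mathbb{Z}^m\},$$ $$\mathrm{Bdd}(f,S)=\{s\in S\mid f(s,\cdot)\text{ is bounded on }\mathbb{Z}^m\},\qquad \mathrm{Iva}(f,S)=\{s\in S\mid f(s,y)=0\text{ for all }y\in\mathbb{Z}^m\}.$$ Let $S$ be a Presburger set. (1) For every $m\ge 0$ and every $f\in\mathcal{P}_q(S\times\mathbb{Z}^m)$ there exist $h_1,h_2,h_3\in\mathcal{P}_q(S)$ with $$\mathrm{Int}(f,S)=Z(h_1),\qquad \mathrm{Bdd}(f,S)=Z(h_2),\qquad \mathrm{Iva}(f,S)=Z(h_3).$$ (2) For every $h\in\mathcal{P}_q(S)$ there exists $f\in\mathcal{P}_q(S\times\mathbb{Z})$ with $$Z(h)=\mathrm{Int}(f,S)=\mathrm{Bdd}(f,S)=\mathrm{Iva}(f,S).$$ (3) Consequently the three classes of subsets of $S$ of the form $\mathrm{Int}(f,S)$, of the form $\mathrm{Bdd}(f,S)$, and of the form $\mathrm{Iva}(f,S)$, where $m\ge 0$ and $f\in\mathcal{P}_q(S\times\mathbb{Z}^m)$ vary, are each equal to the class of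 zero loci $Z(h)$ with $h\in\mathcal{P}_q(S)$. -/

import Mathlib

open MeasureTheory

namespace PresburgerLoci

/-- Presburger sets: the subsets of `ℤ^ι` (with `ι` a finite index type, so that `ℤ^m` is the case
`ι = Fin m`) which are Boolean combinations of sets `{x | f x ≥ 0}` and `{x | f x ≡ 0 mod n}`, where
`f x = c + ∑ i, a i * x i` is a polynomial of degree at most one over `ℤ`, and `n > 0`. -/
inductive IsPresburgerSet {ι : Type*} [Fintype ι] : Set (ι → ℤ) → Prop
  | nonneg (a : ι → ℤ) (c : ℤ) : IsPresburgerSet {x | 0 ≤ c + ∑ i, a i * x i}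
  | modEq (a : ι → ℤ) (c : ℤ) (n : ℕ) (hn : 0 < n) :
      IsPresburgerSet {x | c + ∑ i, a i * x i ≡ 0 [ZMOD n]}
  | compl {A : Set (ι → ℤ)} (hA : IsPresburgerSet A) : IsPresburgerSet Aᶜ
  | inter {A B : Set (ι → ℤ)} (hA : IsPresburgerSet A) (hB : IsPresburgerSet B) :
      IsPresburgerSet (A ∩ B)
  | union {A B : Set (ι → ℤ)} (hA : IsPresburgerSet A) (hB : IsPresburgerSet B) :
      IsPresburgerSet (A ∪ B)

/-- The graph of `α : A → ℤ` with `A ⊆ ℤ^ι`, as a subset of `ℤ^ι × ℤ = ℤ^(ι ⊕ Fin 1)`. -/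
def graph {ι : Type*} {A : Set (ι → ℤ)} (α : A → ℤ) : Set (ι ⊕ Fin 1 → ℤ) :=
  {z | ∃ s : A, z = Sum.elim (s : ι → ℤ) (fun _ => α s)}

/-- A function `A → ℤ` on a Presburger set is a Presburger function if its graph is a
Presburger set. -/
def IsPresburgerFun {ι : Type*} [Fintype ι] {A : Set (ι → ℤ)} (α : A → ℤ) : Prop :=
  IsPresburgerSet (graph α)

/-- The subring `𝔸_q = ℤ[q, q⁻¹, (1 / (1 - q^(-i)))_{i > 0}]` of `ℝ`. -/
def coeffRing (q : ℝ) : Subring ℝ :=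
  Subring.closure ({q, q⁻¹} ∪ {r | ∃ i : ℕ, 0 < i ∧ r = 1 / (1 - q ^ (-(i : ℤ)))})

theorem zpow_mem_coeffRing (q : ℝ) (n : ℤ) : q ^ n ∈ coeffRing q := by
  have h1 : q ∈ coeffRing q := Subring.subset_closure (by simp)
  have h2 : q⁻¹ ∈ coeffRing q := Subring.subset_closure (by simp)
  cases n with
  | ofNat k => simpa using pow_mem h1 k
  | negSucc k =>
    rw [zpow_negSucc, ← inv_pow]
    exact pow_mem h2 (k + 1)

/-- The power `q ^ n`, for an integer `n`, as an element of `𝔸_q`. -/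
noncomputable def qPow (q : ℝ) (n : ℤ) : coeffRing q := ⟨q ^ n, zpow_mem_coeffRing q n⟩

/-- The algebra `𝒫_q(A)` of Presburger constructible functions on `A`: the `𝔸_q`-algebra of
`𝔸_q`-valued functions on `A` generated by the Presburger functions `α : A → ℤ` and the functions
`s ↦ q ^ β(s)` with `β : A → ℤ` a Presburger function. -/
def constructible (q : ℝ) {ι : Type*} [Fintype ι] (A : Set (ι → ℤ)) :
    Subalgebra (coeffRing q) (A → coeffRing q) :=
  Algebra.adjoin (coeffRing q)
    ({g | ∃ α : A → ℤ, IsPresburgerFun α ∧ g = fun s => (α s : coeffRing q)} ∪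
      {g | ∃ β : A → ℤ, IsPresburgerFun β ∧ g = fun s => qPow q (β s)})

/-- The product `S × ℤ^m`, as a subset of `ℤ^ι × ℤ^m = ℤ^(ι ⊕ Fin m)`. -/
def prodInt {ι : Type*} (S : Set (ι → ℤ)) (m : ℕ) : Set (ι ⊕ Fin m → ℤ) :=
  {z | (fun i => z (Sum.inl i)) ∈ S}

/-- The point `(s, y)` of `S × ℤ^m`. -/
def pt {ι : Type*} {S : Set (ι → ℤ)} {m : ℕ} (s : S) (y : Fin m → ℤ) : prodInt S m :=
  ⟨Sum.elim (s : ι → ℤ) y, s.2⟩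

section Loci

variable {q : ℝ} {ι : Type*} {S : Set (ι → ℤ)} {m : ℕ}

/-- The zero locus of a function on `S`. -/
def zeroLocus (h : S → coeffRing q) : Set S := {s | h s = 0}

/-- The locus of integrability of `f` in `S`, for the counting measure on `ℤ^m`. -/
def intLocus (f : prodInt S m → coeffRing q) : Set S :=
  {s | Integrable (fun y : Fin m → ℤ => (f (pt s y) : ℝ)) Measure.count}

/-- The locus of boundedness of `f` in `S`. -/
def bddLocus (f : prodInt S m → coeffRing q) : Set S :=
  {s | Bornology.IsBounded (Set.range fun y : Fin m → ℤ => (f (pt s y) : ℝ))}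

/-- The locus of identical vanishing of `f` in `S`. -/
def ivaLocus (f : prodInt S m → coeffRing q) : Set S :=
  {s | ∀ y : Fin m → ℤ, f (pt s y) = 0}

end Loci

end PresburgerLoci

/-!
All three kinds of loci are reduced to linear recurrences satisfied by constructible functions
along lattice lines.

Presburger sets are the same as semilinear sets (`isPresburgerSet_iff_isSemilinearSet`), so that
`S × ℤ^m` is a finite union of proper linear sets `L = a + ℕ v₁ + ⋯ + ℕ vₖ`, with independent
periods. Given a constructible `f`, the cover can be chosen such that each Presburger function
entering `f` is affine on the pieces, so that `k ↦ f (x + k w)`, for a direction `w` of the lattice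
of `L`, is an exponential polynomial `∑ c_{a,b} k ^ a (q ^ b) ^ k` with `a` and `b` bounded in terms
of `w` only (`exists_properLinear_pieces`). Hence it satisfies a linear recurrence with constant
coefficients in `𝔸_q` and roots `q ^ b`, which depends on `w` but not on `x`.

*Identical vanishing.* By induction it suffices to treat `m = 1`. The fibre of a proper linear set
over `s` is then an interval in an arithmetic progression with fixed step `w`. Because of the
recurrence, `f` vanishes on this fibre as soon as it vanishes at the points at bounded distance from
a point of the fibre that is chosen definably in `s` (`IsSemilinearSet.exists_section`). This is a
finite system of constructible equations in `s`, and the sum of the squares turns it into a single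
one (`isZeroLocus_ivaLocus`).

*Integrability and boundedness.* By Dickson's lemma, each fibre of `L` over `s` is a finite union of
translates of one monoid, generated by vertical directions `w₁, …, wᵣ` which do not depend on `s`
(`IsLinearSet.exists_fibre_monoid`). An exponential polynomial in one variable is summable if and
only if it is annihilated by the factor of the recurrence with roots `q ^ b`, `b < 0`, and bounded
if and only if it is annihilated by the same factor times `E - 1`, where `E` is the shift
(`summableClass`, `boundedClass`). Conversely, if this smaller recurrence holds along every `w_j` at
every point of the fibre, then the growth of `f` on a translate of the monoid is controlled by its
values on a finite box. So the growth condition on `f (s, ·)` means that finitely many constructible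
functions on `S × ℤ^m`, namely the smaller recurrence operators along `w_j` applied to `f`, vanish
identically over `s`, and the first case applies (`isZeroLocus_growth`).

Conversely, the zero locus of `h` is each of the three loci of `(s, y) ↦ h s * y`
(`exists_loci_eq_zeroLocus`).
-/

section

open PresburgerLoci AddSubmonoid Set Pointwise

/-! ### Presburger sets and semilinear sets -/

section Semilinear

variable {ι κ : Type*}

/-- The linear form `x ↦ ∑ i, a i * x i` on `ℤ^ι`. -/
def linForm [Fintype ι] (a : ι → ℤ) : (ι → ℤ) →ₗ[ℤ] ℤ :=
  ∑ i, a i • LinearMap.proj i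

@[simp]
theorem linForm_apply [Fintype ι] (a x : ι → ℤ) : linForm a x = ∑ i, a i * x i := by
  simp [linForm]

theorem isSemilinearSet_nonneg (c : ℤ) : IsSemilinearSet {t : ℤ | 0 ≤ c + t} := by
  refine IsLinearSet.isSemilinearSet ⟨-c, {1}, by simp, ?_⟩
  ext t
  simp only [mem_ofPred_eq, mem_vadd_set, SetLike.mem_coe, mem_closure_singleton, vadd_eq_add]
  constructor
  · intro h
    exact ⟨c + t, ⟨(c + t).toNat, by simpa using h⟩, by ring⟩
  · rintro ⟨_, ⟨n, rfl⟩, rfl⟩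
    simp

theorem isSemilinearSet_modEq (c : ℤ) (n : ℕ) :
    IsSemilinearSet {t : ℤ | c + t ≡ 0 [ZMOD n]} := by
  refine IsLinearSet.isSemilinearSet ⟨-c, {(n : ℤ), -(n : ℤ)}, by simp, ?_⟩
  ext t
  simp only [mem_ofPred_eq, mem_vadd_set, SetLike.mem_coe, mem_closure_pair, vadd_eq_add,
    Int.modEq_zero_iff_dvd]
  constructor
  · rintro ⟨k, hk⟩
    refine ⟨c + t, ⟨k.toNat, (-k).toNat, ?_⟩, by ring⟩
    rw [hk]
    have := Int.toNat_sub_toNat_neg k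
    simp only [nsmul_eq_mul]
    linear_combination (n : ℤ) * this
  · rintro ⟨_, ⟨i, j, rfl⟩, rfl⟩
    exact ⟨i - j, by simp; ring⟩

theorem PresburgerLoci.IsPresburgerSet.isSemilinearSet [Fintype ι] {A : Set (ι → ℤ)}
    (hA : IsPresburgerSet A) : IsSemilinearSet A := by
  induction hA with
  | nonneg a c =>
    simpa [Set.preimage] using (isSemilinearSet_nonneg c).preimage (linForm a)
  | modEq a c n hn =>
    simpa [Set.preimage] using (isSemilinearSet_modEq c n).preimage (linForm a)
  | compl _ ih => exact ih.compl
  | inter _ _ ih₁ ih₂ => exact ih₁.inter ih₂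
  | union _ _ ih₁ ih₂ => exact ih₁.union ih₂

theorem isPresburgerSet_eq_zero [Fintype ι] (a : ι → ℤ) (c : ℤ) :
    IsPresburgerSet {x : ι → ℤ | c + ∑ i, a i * x i = 0} := by
  convert! (IsPresburgerSet.nonneg a c).inter (IsPresburgerSet.nonneg (-a) (-c)) using 1
  ext x
  simp only [mem_ofPred_eq, mem_inter_iff, Pi.neg_apply, neg_mul, Finset.sum_neg_distrib]
  omega

theorem isPresburgerSet_empty [Fintype ι] : IsPresburgerSet (∅ : Set (ι → ℤ)) := by
  convert! IsPresburgerSet.nonneg (ι := ι) 0 (-1)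
  simp

theorem isPresburgerSet_univ [Fintype ι] : IsPresburgerSet (univ : Set (ι → ℤ)) := by
  simpa using (isPresburgerSet_empty (ι := ι)).compl

theorem PresburgerLoci.IsPresburgerSet.iInter [Fintype ι] {κ : Type*} [Finite κ]
    {A : κ → Set (ι → ℤ)} (hA : ∀ k, IsPresburgerSet (A k)) : IsPresburgerSet (⋂ k, A k) := by
  suffices h : ∀ S : Set (Set (ι → ℤ)), S.Finite → (∀ t ∈ S, IsPresburgerSet t) →
      IsPresburgerSet (⋂₀ S) by
    rw [← sInter_range]
    exact h _ (finite_range A) (by simpa using hA)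
  intro S hS hS'
  induction S, hS using Finite.induction_on with
  | empty => simpa using isPresburgerSet_univ
  | insert _ _ ih =>
    simp_rw [mem_insert_iff, forall_eq_or_imp] at hS'
    simpa using hS'.1.inter (ih hS'.2)

theorem PresburgerLoci.IsPresburgerSet.sUnion [Fintype ι] {S : Set (Set (ι → ℤ))} (hS : S.Finite)
    (hS' : ∀ t ∈ S, IsPresburgerSet t) : IsPresburgerSet (⋃₀ S) := by
  induction S, hS using Finite.induction_on with
  | empty => simpa using isPresburgerSet_empty
  | insert _ _ ih =>
    simp_rw [mem_insert_iff, forall_eq_or_imp] at hS'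
    simpa using hS'.1.union (ih hS'.2)

/-- A proper linear set is the injective image of an orthant `ℕ^k` under an affine map. -/
theorem IsProperLinearSet.exists_linearIndependent {L : Set (ι → ℤ)} (hL : IsProperLinearSet L) :
    ∃ (a : ι → ℤ) (k : ℕ) (v : Fin k → ι → ℤ), LinearIndependent ℤ v ∧
      ∀ x, x ∈ L ↔ ∃ n : Fin k → ℕ, x = a + ∑ j, n j • v j := by
  classical
  rw [isProperLinearSet_iff] at hL
  obtain ⟨a, t, ht, rfl⟩ := hL
  let e := t.equivFin
  refine ⟨a, t.card, fun j => (e.symm j : ι → ℤ), ?_, fun x => ?_⟩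
  · have h1 : LinearIndependent ℕ (fun j => (e.symm j : ι → ℤ)) :=
      LinearIndependent.comp (R := ℕ) (v := fun i : t => (i : ι → ℤ)) ht e.symm e.symm.injective
    rw [Fintype.linearIndependent_iffₛ] at h1
    rw [Fintype.linearIndependent_iff]
    intro g hg j
    have h2 := h1 (fun j => (g j).toNat) (fun j => (-g j).toNat) ?_ j
    · omega
    · rw [← sub_eq_zero, ← Finset.sum_sub_distrib, ← hg]
      refine Finset.sum_congr rfl fun i _ => ?_
      rw [← natCast_zsmul, ← natCast_zsmul, ← sub_smul, Int.toNat_sub_toNat_neg]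
  · rw [mem_vadd_set]
    simp only [SetLike.mem_coe, vadd_eq_add, mem_closure_finset]
    constructor
    · rintro ⟨y, ⟨f, -, rfl⟩, rfl⟩
      refine ⟨fun j => f (e.symm j), ?_⟩
      rw [← Finset.sum_coe_sort, ← e.symm.sum_comp]
    · rintro ⟨n, rfl⟩
      refine ⟨_, ⟨fun x => if h : x ∈ t then n (e ⟨x, h⟩) else 0, ?_, rfl⟩, ?_⟩
      · intro x hx
        by_contra h
        exact hx (dif_neg h)
      · congr 1
        rw [← Finset.sum_coe_sort, ← e.symm.sum_comp]
        simp

/-- Linearly independent integer vectors have an integral left inverse up to a positive factor. -/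
theorem LinearIndependent.exists_int_leftInverse [Fintype ι] {k : ℕ} {v : Fin k → ι → ℤ}
    (hv : LinearIndependent ℤ v) :
    ∃ (d : ℕ) (B : Fin k → ι → ℤ), 0 < d ∧
      ∀ j j', ∑ i, B j i * v j' i = if j = j' then (d : ℤ) else 0 := by
  classical
  let w : Fin k → ι → ℚ := fun j i => (v j i : ℚ)
  have hw : LinearIndependent ℚ w := by
    rw [← LinearIndependent.iff_fractionRing ℤ ℚ]
    let f : (ι → ℤ) →ₗ[ℤ] (ι → ℚ) :=
      { toFun := fun x i => (x i : ℚ)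
        map_add' := fun x y => by ext; simp
        map_smul' := fun c x => by ext; simp }
    refine hv.map' f (LinearMap.ker_eq_bot.2 fun x y h => funext fun i => ?_)
    simpa [f] using congrFun h i
  obtain ⟨g, hg⟩ := LinearMap.exists_leftInverse_of_injective (Fintype.linearCombination ℚ w)
    (LinearMap.ker_eq_bot.2 (hw.fintypeLinearCombination_injective))
  obtain ⟨b, hb⟩ := IsLocalization.exist_integer_multiples_of_finset (nonZeroDivisors ℤ)
    ((Finset.univ : Finset (Fin k × ι)).image fun p => g (Pi.single p.2 1) p.1)
  have hb0 : (b : ℤ) ≠ 0 := nonZeroDivisors.ne_zero b.2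
  have hb' : ∀ j i, ∃ z : ℤ, (z : ℚ) = (b : ℤ) * g (Pi.single i 1) j := fun j i => by
    obtain ⟨z, hz⟩ := hb _ (Finset.mem_image_of_mem _ (Finset.mem_univ (j, i)))
    exact ⟨z, by simpa using hz⟩
  choose B hB using hb'
  refine ⟨b.1.natAbs, fun j i => b.1.sign * B j i, by positivity, fun j j' => ?_⟩
  have h1 : g (w j') j = if j = j' then 1 else 0 := by
    have := congrFun (LinearMap.congr_fun hg (Pi.single j' 1)) j
    simpa [Pi.single_apply] using this
  have h2 : w j' = ∑ i, w j' i • Pi.single i (1 : ℚ) := by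
    ext i
    simp [Finset.sum_apply, Pi.single_apply]
  rw [h2, map_sum, Finset.sum_apply] at h1
  simp only [map_smul, Pi.smul_apply, smul_eq_mul] at h1
  have h3 : (∑ i, B j i * v j' i : ℤ) = if j = j' then (b : ℤ) else 0 := by
    have : ((∑ i, B j i * v j' i : ℤ) : ℚ) = (b : ℤ) * ∑ i, w j' i * g (Pi.single i 1) j := by
      push_cast
      rw [Finset.mul_sum]
      exact Finset.sum_congr rfl fun i _ => by rw [hB]; simp only [w]; ring
    rw [h1] at this
    split_ifs at this ⊢ <;> exact Int.cast_injective (α := ℚ) (by simpa using this)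
  simp_rw [mul_assoc]
  rw [← Finset.mul_sum, h3]
  split_ifs
  · simp
  · simp

theorem IsProperLinearSet.isPresburgerSet [Fintype ι] {L : Set (ι → ℤ)}
    (hL : IsProperLinearSet L) : IsPresburgerSet L := by
  classical
  obtain ⟨a, k, v, hv, hmem⟩ := hL.exists_linearIndependent
  obtain ⟨d, B, hd, hB⟩ := hv.exists_int_leftInverse
  -- `z j x` is `d` times the `j`-th coordinate of `x - a` with respect to the periods.
  let c : Fin k → ℤ := fun j => -∑ i, B j i * a i
  let z : Fin k → (ι → ℤ) → ℤ := fun j x => c j + ∑ i, B j i * x i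
  have hz : ∀ j x, z j x = ∑ i, B j i * (x - a) i := fun j x => by
    simp only [z, c, Pi.sub_apply, mul_sub, Finset.sum_sub_distrib]
    ring
  have key : L = (⋂ j, {x | 0 ≤ z j x}) ∩ (⋂ j, {x | z j x ≡ 0 [ZMOD d]}) ∩
      ⋂ i, {x | (∑ j, v j i * c j + d * a i) +
        ∑ i', ((∑ j, v j i * B j i') - if i' = i then (d : ℤ) else 0) * x i' = 0} := by
    have heq : ∀ i x, (∑ j, v j i * c j + d * a i) +
        ∑ i', ((∑ j, v j i * B j i') - if i' = i then (d : ℤ) else 0) * x i' =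
        ∑ j, v j i * z j x - d * (x - a) i := fun i x => by
      simp only [z, mul_add, Finset.sum_add_distrib, sub_mul, Finset.sum_sub_distrib, ite_mul,
        zero_mul, Finset.sum_ite_eq', Finset.mem_univ, if_true, Pi.sub_apply, Finset.sum_mul,
        Finset.mul_sum, mul_assoc]
      rw [Finset.sum_comm]
      ring
    ext x
    simp only [mem_inter_iff, mem_iInter, mem_ofPred_eq, heq, hmem, Int.modEq_zero_iff_dvd]
    constructor
    · rintro ⟨n, rfl⟩
      have h : ∀ j, z j (a + ∑ j, n j • v j) = d * n j := fun j => by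
        rw [hz, add_sub_cancel_left]
        simp only [Finset.sum_apply, Pi.smul_apply, Int.nsmul_eq_mul, Finset.mul_sum]
        rw [Finset.sum_comm]
        have h' : ∀ j', ∑ i, B j i * (n j' * v j' i) = if j = j' then (d * n j : ℤ) else 0 := by
          intro j'
          rw [Finset.sum_congr rfl fun i _ => mul_left_comm (B j i) _ _, ← Finset.mul_sum, hB]
          split_ifs with hj
          · rw [hj, mul_comm]
          · simp
        simp [h']
      simp only [h]
      refine ⟨⟨fun j => by positivity, fun j => ⟨_, rfl⟩⟩, fun i => ?_⟩
      simp only [add_sub_cancel_left, Finset.sum_apply, Pi.smul_apply, Int.nsmul_eq_mul,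
        Finset.mul_sum, ← Finset.sum_sub_distrib]
      exact Finset.sum_eq_zero fun j _ => by ring
    · rintro ⟨⟨h1, h2⟩, h3⟩
      choose n hn using h2
      have hd' : (0 : ℤ) < d := by exact_mod_cast hd
      have hn0 : ∀ j, 0 ≤ n j := fun j => by
        have := h1 j
        rw [hn] at this
        exact nonneg_of_mul_nonneg_right this hd'
      refine ⟨fun j => (n j).toNat, funext fun i => ?_⟩
      have h4 := h3 i
      simp only [hn] at h4
      have h5 : (d : ℤ) * (∑ j, n j * v j i - (x - a) i) = 0 := by
        rw [← h4, mul_sub, Finset.mul_sum]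
        congr 1
        exact Finset.sum_congr rfl fun j _ => by ring
      have h6 := (mul_eq_zero.1 h5).resolve_left hd'.ne'
      simp only [Pi.add_apply, Finset.sum_apply, Pi.smul_apply, Int.nsmul_eq_mul, hn0,
        Int.toNat_of_nonneg]
      simp only [Pi.sub_apply] at h6
      linarith
  rw [key]
  exact ((IsPresburgerSet.iInter fun j => .nonneg _ _).inter
    (IsPresburgerSet.iInter fun j => .modEq _ _ d hd)).inter
    (IsPresburgerSet.iInter fun i => isPresburgerSet_eq_zero _ _)

/-- The Presburger sets are exactly the semilinear sets. -/
theorem isPresburgerSet_iff_isSemilinearSet [Fintype ι] {A : Set (ι → ℤ)} :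
    IsPresburgerSet A ↔ IsSemilinearSet A := by
  refine ⟨fun h => h.isSemilinearSet, fun h => ?_⟩
  obtain ⟨S, hS, hS', rfl⟩ := h.isProperSemilinearSet
  exact .sUnion hS fun t ht => (hS' t ht).isPresburgerSet

end Semilinear

/-! ### Presburger maps and constructible functions -/

section Maps

variable {ι κ : Type*}

theorem IsSemilinearSet.reindex [Finite ι] {s : Set (κ → ℤ)} (hs : IsSemilinearSet s)
    (e : κ → ι) : IsSemilinearSet {x : ι → ℤ | x ∘ e ∈ s} :=
  hs.preimage (LinearMap.funLeft ℤ ℤ e)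

theorem IsSemilinearSet.preimage_add [Finite ι] {s : Set (ι → ℤ)} (hs : IsSemilinearSet s)
    (a : ι → ℤ) : IsSemilinearSet {x : ι → ℤ | x + a ∈ s} := by
  convert! hs.vadd (-a) using 1
  ext x
  simp [mem_vadd_set_iff_neg_vadd_mem, add_comm]

theorem IsSemilinearSet.setOf_linForm_eq [Fintype ι] (a : ι → ℤ) (c : ℤ) :
    IsSemilinearSet {x : ι → ℤ | ∑ i, a i * x i = c} := by
  simpa [Set.preimage] using (IsSemilinearSet.singleton c).preimage (linForm a)

theorem isSemilinearSet_apply_eq [Finite ι] (i : ι) (c : ℤ) :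
    IsSemilinearSet {x : ι → ℤ | x i = c} :=
  (IsSemilinearSet.singleton c).preimage (LinearMap.proj (R := ℤ) (φ := fun _ : ι => ℤ) i)

theorem mem_graph_iff {A : Set (ι → ℤ)} {α : A → ℤ} {z : ι ⊕ Fin 1 → ℤ} :
    z ∈ graph α ↔ ∃ h : z ∘ Sum.inl ∈ A, z (Sum.inr 0) = α ⟨_, h⟩ := by
  constructor
  · rintro ⟨s, rfl⟩
    exact ⟨by simp, by simp⟩
  · rintro ⟨h, hz⟩
    refine ⟨⟨_, h⟩, ?_⟩
    ext (i | i)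
    · simp
    · rw [Subsingleton.elim i 0]
      simpa using hz

variable [Fintype ι] [Fintype κ] {A : Set (ι → ℤ)} {B : Set (κ → ℤ)}

theorem isPresburgerFun_iff {α : A → ℤ} : IsPresburgerFun α ↔ IsSemilinearSet (graph α) :=
  isPresburgerSet_iff_isSemilinearSet

/-- A map between subsets of `ℤ^κ` and `ℤ^ι` whose graph is semilinear. -/
def IsPresburgerMap (φ : B → A) : Prop :=
  IsSemilinearSet {z : κ ⊕ ι → ℤ | ∃ h : z ∘ Sum.inl ∈ B, z ∘ Sum.inr = φ ⟨_, h⟩}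

theorem PresburgerLoci.IsPresburgerFun.comp {α : A → ℤ} (hα : IsPresburgerFun α) {φ : B → A}
    (hφ : IsPresburgerMap φ) : IsPresburgerFun (α ∘ φ) := by
  rw [isPresburgerFun_iff] at hα ⊢
  have h1 := hφ.reindex (ι := (κ ⊕ Fin 1) ⊕ ι) (Sum.elim (Sum.inl ∘ Sum.inl) Sum.inr)
  have h2 := hα.reindex (ι := (κ ⊕ Fin 1) ⊕ ι) (Sum.elim Sum.inr (Sum.inl ∘ Sum.inr))
  convert! (h1.inter h2).proj using 1
  ext z
  simp only [mem_ofPred_eq, mem_inter_iff, mem_graph_iff]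
  constructor
  · rintro ⟨h, hz⟩
    exact ⟨φ ⟨_, h⟩, ⟨h, rfl⟩, (φ ⟨_, h⟩).2, hz⟩
  · rintro ⟨y, ⟨h, hy⟩, h', hz⟩
    refine ⟨h, hz.trans ?_⟩
    simp only [Function.comp_apply]
    congr 1
    exact Subtype.ext hy

variable {q : ℝ}

theorem constructible_comp {f : A → coeffRing q} (hf : f ∈ constructible q A) {φ : B → A}
    (hφ : IsPresburgerMap φ) : f ∘ φ ∈ constructible q B := by
  induction hf using Algebra.adjoin_induction with
  | mem f hf =>
    refine Algebra.subset_adjoin ?_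
    rcases hf with ⟨α, hα, rfl⟩ | ⟨α, hα, rfl⟩
    · exact Or.inl ⟨α ∘ φ, hα.comp hφ, rfl⟩
    · exact Or.inr ⟨α ∘ φ, hα.comp hφ, rfl⟩
  | algebraMap r => exact (constructible q B).algebraMap_mem r
  | add f g _ _ hf hg => exact add_mem hf hg
  | mul f g _ _ hf hg => exact mul_mem hf hg

theorem intCast_mem_constructible {α : A → ℤ} (hα : IsPresburgerFun α) :
    (fun s => (α s : coeffRing q)) ∈ constructible q A :=
  Algebra.subset_adjoin (Or.inl ⟨α, hα, rfl⟩)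

open Classical in
theorem isPresburgerFun_indicator (hA : IsSemilinearSet A) {T : Set (ι → ℤ)}
    (hT : IsSemilinearSet T) :
    IsPresburgerFun (fun s : A => if (s : ι → ℤ) ∈ T then (1 : ℤ) else 0) := by
  rw [isPresburgerFun_iff]
  convert! (((hA.inter hT).reindex (ι := ι ⊕ Fin 1) Sum.inl).inter
    (isSemilinearSet_apply_eq (Sum.inr 0) 1)).union
    (((hA.inter hT.compl).reindex (ι := ι ⊕ Fin 1) Sum.inl).inter
    (isSemilinearSet_apply_eq (Sum.inr 0) 0)) using 1
  ext z
  simp only [mem_graph_iff, mem_union, mem_inter_iff, mem_ofPred_eq, mem_compl_iff]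
  by_cases h : z ∘ Sum.inl ∈ T <;> simp [h]

open Classical in
theorem indicator_mem_constructible (hA : IsSemilinearSet A) {T : Set (ι → ℤ)}
    (hT : IsSemilinearSet T) :
    (fun s : A => if (s : ι → ℤ) ∈ T then (1 : coeffRing q) else 0) ∈ constructible q A := by
  convert! intCast_mem_constructible (q := q) (isPresburgerFun_indicator hA hT) using 2
  split_ifs <;> simp

theorem isPresburgerFun_apply (hA : IsSemilinearSet A) (i : ι) :
    IsPresburgerFun (fun s : A => (s : ι → ℤ) i) := by
  classical
  rw [isPresburgerFun_iff]
  convert! (hA.reindex (ι := ι ⊕ Fin 1) Sum.inl).inter (IsSemilinearSet.setOf_linForm_eq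
    (Pi.single (Sum.inr 0) 1 - Pi.single (Sum.inl i) 1 : ι ⊕ Fin 1 → ℤ) 0) using 1
  ext z
  simp only [mem_graph_iff, mem_inter_iff, mem_ofPred_eq, Pi.sub_apply, sub_mul,
    Finset.sum_sub_distrib, Pi.single_apply, ite_mul, one_mul, zero_mul, Finset.sum_ite_eq',
    Finset.mem_univ, if_true, sub_eq_zero, exists_prop, Function.comp_apply]

/-- Maps given by selecting coordinates and translating are Presburger. -/
theorem isPresburgerMap_of_reindex (hB : IsSemilinearSet B) {φ : B → A} (e : ι → κ) (a : ι → ℤ)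
    (hφ : ∀ b : B, (φ b : ι → ℤ) = (b : κ → ℤ) ∘ e + a) : IsPresburgerMap φ := by
  classical
  unfold IsPresburgerMap
  have h : IsSemilinearSet {z : κ ⊕ ι → ℤ | ∀ i, z (Sum.inr i) = z (Sum.inl (e i)) + a i} := by
    rw [ofPred_forall]
    refine .iInter fun i => ?_
    convert! IsSemilinearSet.setOf_linForm_eq
      (Pi.single (Sum.inr i) 1 - Pi.single (Sum.inl (e i)) 1 : κ ⊕ ι → ℤ) (a i) using 1
    ext z
    simp only [mem_ofPred_eq, Pi.sub_apply, sub_mul,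
      Finset.sum_sub_distrib, Pi.single_apply, ite_mul, one_mul, zero_mul, Finset.sum_ite_eq',
      Finset.mem_univ, if_true]
    omega
  convert! (hB.reindex (ι := κ ⊕ ι) Sum.inl).inter h using 1
  ext z
  simp only [mem_ofPred_eq, mem_inter_iff, hφ, exists_prop, funext_iff, Function.comp_apply,
    Pi.add_apply]

theorem PresburgerLoci.isSemilinearSet_prodInt {S : Set (ι → ℤ)} (hS : IsSemilinearSet S) (m : ℕ) :
    IsSemilinearSet (prodInt S m) :=
  hS.reindex Sum.inl

end Maps

/-! ### Exponential polynomials and linear recurrences -/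

section Recurrence

open Polynomial

/-- The shift operator `u ↦ (k ↦ u (k + 1))` on real sequences. -/
def seqShift : Module.End ℝ (ℕ → ℝ) where
  toFun u k := u (k + 1)
  map_add' _ _ := rfl
  map_smul' _ _ := rfl

/-- The polynomial `∏ (X - q ^ b)`, where `b` runs over a multiset of integers. -/
noncomputable def rootPoly (q : ℝ) (s : Multiset ℤ) : (coeffRing q)[X] :=
  (s.map fun b => X - C (qPow q b)).prod

/-- The linear recurrence operator `∏ (E - q ^ b)`, where `E` is the shift of sequences. -/
noncomputable def recOp (q : ℝ) (s : Multiset ℤ) : Module.End ℝ (ℕ → ℝ) :=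
  aeval seqShift (rootPoly q s)

variable {q : ℝ}

theorem aeval_seqShift_apply (P : (coeffRing q)[X]) (u : ℕ → ℝ) (k : ℕ) :
    aeval seqShift P u k = P.sum fun i c => (c : ℝ) * u (k + i) := by
  have hpow : ∀ i, (seqShift ^ i) u k = u (k + i) := by
    intro i
    induction i generalizing k with
    | zero => rfl
    | succ i ih =>
      rw [pow_succ']
      change (seqShift ^ i) u (k + 1) = _
      rw [ih]
      congr 1
      omega
  rw [aeval_def, eval₂_eq_sum, sum_def, sum_def, LinearMap.sum_apply, Finset.sum_apply]
  refine Finset.sum_congr rfl fun i _ => ?_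
  rw [← hpow]
  rfl

@[simp]
theorem recOp_zero (u : ℕ → ℝ) : recOp q 0 u = u := by
  simp [recOp, rootPoly]

theorem recOp_add (s t : Multiset ℤ) (u : ℕ → ℝ) :
    recOp q (s + t) u = recOp q s (recOp q t u) := by
  simp [recOp, rootPoly]

theorem recOp_singleton_apply (b : ℤ) (u : ℕ → ℝ) (k : ℕ) :
    recOp q {b} u k = u (k + 1) - q ^ b * u k := by
  simp only [recOp, rootPoly, Multiset.map_singleton, Multiset.prod_singleton, map_sub, aeval_X,
    aeval_C]
  rfl

theorem recOp_cons (b : ℤ) (s : Multiset ℤ) (u : ℕ → ℝ) :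
    recOp q (b ::ₘ s) u = recOp q s (recOp q {b} u) := by
  rw [← Multiset.singleton_add, add_comm, recOp_add]

theorem recOp_cons' (b : ℤ) (s : Multiset ℤ) (u : ℕ → ℝ) :
    recOp q (b ::ₘ s) u = recOp q {b} (recOp q s u) := by
  rw [← Multiset.singleton_add, recOp_add]

/-- A solution of a linear recurrence of order `d` whose first `d` values vanish is zero. -/
theorem eq_zero_of_recOp_eq_zero {s : Multiset ℤ} {u : ℕ → ℝ} (hu : recOp q s u = 0)
    (h0 : ∀ k < s.card, u k = 0) : u = 0 := by
  induction s using Multiset.induction generalizing u with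
  | empty => simpa using hu
  | cons b s ih =>
    rw [recOp_cons] at hu
    rw [Multiset.card_cons] at h0
    have h1 := ih hu fun k hk => by
      rw [recOp_singleton_apply, h0 k (by omega), h0 (k + 1) (by omega)]
      simp
    funext k
    induction k with
    | zero => exact h0 0 (by omega)
    | succ k ihk =>
      have := congrFun h1 k
      rw [recOp_singleton_apply, ihk] at this
      simpa using this

/-- The space of exponential polynomials `k ↦ ∑ c_{a,b} k ^ a (q ^ b) ^ k` with `a ≤ D`,
`|b| ≤ D`. -/
def expPoly (q : ℝ) (D : ℕ) : Submodule ℝ (ℕ → ℝ) :=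
  Submodule.span ℝ {u | ∃ a : ℕ, ∃ b : ℤ, a ≤ D ∧ |b| ≤ D ∧ u = fun k : ℕ => (k : ℝ) ^ a * (q ^ b) ^ k}

theorem monomial_mem_expPoly {D a : ℕ} {b : ℤ} (ha : a ≤ D) (hb : |b| ≤ D) :
    (fun k : ℕ => (k : ℝ) ^ a * (q ^ b) ^ k) ∈ expPoly q D :=
  Submodule.subset_span ⟨a, b, ha, hb, rfl⟩

theorem expPoly_mono {D E : ℕ} (h : D ≤ E) : expPoly q D ≤ expPoly q E := by
  refine Submodule.span_mono ?_
  rintro _ ⟨a, b, ha, hb, rfl⟩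
  exact ⟨a, b, ha.trans h, hb.trans (by exact_mod_cast h), rfl⟩

theorem mul_mem_expPoly (hq : q ≠ 0) {D E : ℕ} {u v : ℕ → ℝ} (hu : u ∈ expPoly q D)
    (hv : v ∈ expPoly q E) : u * v ∈ expPoly q (D + E) := by
  induction hu using Submodule.span_induction with
  | mem u hu =>
    obtain ⟨a, b, ha, hb, rfl⟩ := hu
    induction hv using Submodule.span_induction with
    | mem v hv =>
      obtain ⟨a', b', ha', hb', rfl⟩ := hv
      convert! monomial_mem_expPoly (q := q) (add_le_add ha ha')
        ((abs_add_le b b').trans (by push_cast; exact add_le_add hb hb')) using 1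
      funext k
      simp only [Pi.mul_apply, zpow_add₀ hq]
      ring
    | zero => simp
    | add v w _ _ hv hw => rw [mul_add]; exact add_mem hv hw
    | smul c v _ hv => rw [mul_smul_comm]; exact Submodule.smul_mem _ c hv
  | zero => simp
  | add v w _ _ hv hw => rw [add_mul]; exact add_mem hv hw
  | smul c v _ hv => rw [smul_mul_assoc]; exact Submodule.smul_mem _ c hv

theorem const_mem_expPoly (c : ℝ) : (fun _ => c) ∈ expPoly q 0 := by
  convert! Submodule.smul_mem _ c (monomial_mem_expPoly (q := q) (a := 0) (b := 0) le_rfl (by simp))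
    using 1
  funext k
  simp

theorem affine_mem_expPoly (a c : ℝ) : (fun k : ℕ => a + k * c) ∈ expPoly q 1 := by
  have h1 := Submodule.smul_mem _ c (monomial_mem_expPoly (q := q) (D := 1) (a := 1) (b := 0) le_rfl
    (by simp))
  convert! add_mem (expPoly_mono (by simp) (const_mem_expPoly a)) h1 using 1
  funext k
  simp [mul_comm]

theorem geometric_mem_expPoly (c : ℝ) (b : ℤ) :
    (fun k : ℕ => c * (q ^ b) ^ k) ∈ expPoly q b.natAbs := by
  convert! Submodule.smul_mem _ c (monomial_mem_expPoly (q := q) (a := 0) (b := b)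
    (D := b.natAbs) (by simp) (by simp)) using 1
  funext k
  simp

/-- The exponents, with multiplicity, of the characteristic roots of the exponential polynomials
of order `D`. -/
noncomputable def allRoots (D : ℕ) : Multiset ℤ := (D + 1) • (Finset.Icc (-(D : ℤ)) D).val

theorem count_allRoots {D : ℕ} {b : ℤ} (hb : |b| ≤ D) : (allRoots D).count b = D + 1 := by
  rw [allRoots, Multiset.count_nsmul, Multiset.count_eq_one_of_mem (Finset.nodup _), mul_one]
  rw [abs_le] at hb
  simpa using hb

theorem recOp_replicate_monomial {n a : ℕ} (b : ℤ) (h : a < n) :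
    recOp q (Multiset.replicate n b) (fun k : ℕ => (k : ℝ) ^ a * (q ^ b) ^ k) = 0 := by
  induction n generalizing a with
  | zero => omega
  | succ n ih =>
    rw [Multiset.replicate_succ, recOp_cons]
    have h1 : recOp q {b} (fun k : ℕ => (k : ℝ) ^ a * (q ^ b) ^ k) =
        ∑ i ∈ Finset.range a, (q ^ b * a.choose i) •
          (fun k : ℕ => (k : ℝ) ^ i * (q ^ b) ^ k) := by
      funext k
      rw [recOp_singleton_apply]
      push_cast
      rw [add_pow, Finset.sum_range_succ, Finset.sum_apply]
      simp only [one_pow, mul_one, Nat.choose_self, Nat.cast_one, Pi.smul_apply, smul_eq_mul]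
      rw [add_mul, Finset.sum_mul]
      have : ∀ i, (k : ℝ) ^ i * (a.choose i) * (q ^ b) ^ (k + 1) =
        q ^ b * (a.choose i) * ((k : ℝ) ^ i * (q ^ b) ^ k) := fun i => by ring
      simp only [this]
      ring
    rw [h1, map_sum]
    refine Finset.sum_eq_zero fun i hi => ?_
    rw [Finset.mem_range] at hi
    rw [map_smul, ih (by omega), smul_zero]

/-- Exponential polynomials of order `D` satisfy the recurrence with roots `allRoots D`. -/
theorem recOp_allRoots_eq_zero {D : ℕ} {u : ℕ → ℝ} (hu : u ∈ expPoly q D) :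
    recOp q (allRoots D) u = 0 := by
  induction hu using Submodule.span_induction with
  | mem u hu =>
    obtain ⟨a, b, ha, hb, rfl⟩ := hu
    have h1 : Multiset.replicate (D + 1) b ≤ allRoots D :=
      Multiset.le_count_iff_replicate_le.1 (count_allRoots hb).ge
    obtain ⟨t, ht⟩ := Multiset.le_iff_exists_add.1 h1
    rw [ht, add_comm, recOp_add, recOp_replicate_monomial b (by omega), map_zero]
  | zero => simp
  | add v w _ _ hv hw => rw [map_add, hv, hw, add_zero]
  | smul c v _ hv => rw [map_smul, hv, smul_zero]

end Recurrence

/-! ### Growth classes -/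

section Growth

/-- A condition on the growth of families of real numbers which, on exponential polynomials, is
equivalent to a linear recurrence: a family of exponential polynomials of order `D` satisfying the
condition has no characteristic roots but those in `roots D`, and conversely solutions of
this smaller recurrence satisfy the condition as soon as their initial values do. -/
structure GrowthClass (q : ℝ) where
  /-- The growth condition. -/
  Mem : ∀ {I : Type}, (I → ℝ) → Prop
  comp : ∀ {I J : Type} {f : I → ℝ} (φ : J → I), Function.Injective φ → Mem f → Mem (f ∘ φ)
  of_cover : ∀ {I J : Type} [Finite J] {K : J → Type} {f : I → ℝ} (φ : ∀ j, K j → I),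
    (∀ i, ∃ j k, φ j k = i) → (∀ j, Mem (f ∘ φ j)) → Mem f
  mem_of_finite : ∀ {I : Type} [Finite I] (f : I → ℝ), Mem f
  /-- The exponents of the characteristic roots which the growth condition permits. -/
  roots : ℕ → Multiset ℤ
  recOp_eq_zero : ∀ {D : ℕ} {u : ℕ → ℝ}, u ∈ expPoly q D → Mem u → recOp q (roots D) u = 0
  mem_of_recOp : ∀ {D : ℕ} {I : Type} {h : I → ℕ → ℝ}, (∀ i, recOp q (roots D) (h i) = 0) →
    (∀ k, Mem fun i => h i k) → Mem fun p : ℕ × I => h p.2 p.1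

variable {q : ℝ}

/-- If a property of sequences is preserved by the factors of a recurrence operator, then it is
preserved by the operator. -/
theorem recOp_induction {P : (ℕ → ℝ) → Prop} (hP : ∀ b u, P u → P (recOp q {b} u))
    (s : Multiset ℤ) {u : ℕ → ℝ} (hu : P u) : P (recOp q s u) := by
  induction s using Multiset.induction with
  | empty => simpa using hu
  | cons b s ih => rw [recOp_cons']; exact hP b _ ih

/-- If the factors `E - q ^ b`, for `b ∈ t`, are injective on a class of sequences stable under
recurrence operators, then they can be cancelled. -/
theorem recOp_cancel {P : (ℕ → ℝ) → Prop} (hP : ∀ b u, P u → P (recOp q {b} u))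
    {t : Multiset ℤ} (ht : ∀ b ∈ t, ∀ u, P u → recOp q {b} u = 0 → u = 0)
    {s : Multiset ℤ} {u : ℕ → ℝ} (hu : P u) (h : recOp q (s + t) u = 0) : recOp q s u = 0 := by
  induction t using Multiset.induction with
  | empty => simpa using h
  | cons b t ih =>
    refine ih (fun b hb => ht b (Multiset.mem_cons_of_mem hb)) ?_
    rw [Multiset.add_cons, recOp_cons'] at h
    exact ht b (Multiset.mem_cons_self b t) _ (recOp_induction hP _ hu) h

theorem eq_pow_mul_of_recOp_singleton {b : ℤ} {u : ℕ → ℝ} (h : recOp q {b} u = 0) (k : ℕ) :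
    u k = (q ^ b) ^ k * u 0 := by
  induction k with
  | zero => simp
  | succ k ih =>
    have := congrFun h k
    rw [recOp_singleton_apply, Pi.zero_apply, sub_eq_zero, ih] at this
    rw [this]
    ring

/-- A family of real numbers is bounded. -/
def BoundedFamily {I : Type} (f : I → ℝ) : Prop := ∃ B, ∀ i, |f i| ≤ B

theorem BoundedFamily.recOp_singleton {I : Type} {h : I → ℕ → ℝ} (b : ℤ)
    (hh : ∀ k, BoundedFamily fun i => h i k) (k : ℕ) :
    BoundedFamily fun i => _root_.recOp q {b} (h i) k := by
  obtain ⟨B, hB⟩ := hh k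
  obtain ⟨B', hB'⟩ := hh (k + 1)
  refine ⟨B' + |q ^ b| * B, fun i => ?_⟩
  change |_root_.recOp q {b} (h i) k| ≤ _
  rw [recOp_singleton_apply]
  refine (abs_sub _ _).trans (add_le_add (hB' i) ?_)
  rw [abs_mul]
  exact mul_le_mul_of_nonneg_left (hB i) (abs_nonneg _)

theorem BoundedFamily.recOp {I : Type} {h : I → ℕ → ℝ} (s : Multiset ℤ)
    (hh : ∀ k, BoundedFamily fun i => h i k) (k : ℕ) :
    BoundedFamily fun i => _root_.recOp q s (h i) k := by
  induction s using Multiset.induction generalizing h with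
  | empty => simpa using hh k
  | cons b s ih =>
    simp only [recOp_cons]
    exact ih (BoundedFamily.recOp_singleton b hh)

theorem zpow_pos_lt_one (hq : 1 < q) {b : ℤ} (hb : b < 0) : 0 < q ^ b ∧ q ^ b < 1 :=
  ⟨zpow_pos (by linarith) b, zpow_lt_one_of_neg₀ hq hb⟩

/-- A contracting recurrence with bounded right-hand side and bounded initial values has bounded
solutions. -/
theorem BoundedFamily.of_recOp (hq : 1 < q) {I : Type} {h : I → ℕ → ℝ} {s : Multiset ℤ}
    (hs : ∀ b ∈ s, b < 0) (hh : ∀ k, BoundedFamily fun i => h i k)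
    (hr : ∃ B, ∀ i k, |_root_.recOp q s (h i) k| ≤ B) : ∃ B, ∀ i k, |h i k| ≤ B := by
  induction s using Multiset.induction generalizing h with
  | empty => simpa using hr
  | cons b s ih =>
    simp only [recOp_cons] at hr
    obtain ⟨B, hB⟩ := ih (fun b hb => hs b (Multiset.mem_cons_of_mem hb))
      (BoundedFamily.recOp_singleton b hh) hr
    obtain ⟨B₀, hB₀⟩ := hh 0
    obtain ⟨h0, h1⟩ := zpow_pos_lt_one hq (hs b (Multiset.mem_cons_self b s))
    refine ⟨max B₀ (B / (1 - q ^ b)), fun i k => ?_⟩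
    induction k with
    | zero => exact (hB₀ i).trans (le_max_left _ _)
    | succ k ihk =>
      have h2 := hB i k
      rw [recOp_singleton_apply] at h2
      have h3 : |h i (k + 1)| ≤ B + q ^ b * |h i k| := by
        have := abs_sub_abs_le_abs_sub (h i (k + 1)) (q ^ b * h i k)
        rw [abs_mul, abs_of_pos h0] at this
        linarith
      have h4 : B ≤ (1 - q ^ b) * max B₀ (B / (1 - q ^ b)) := by
        have := le_max_right B₀ (B / (1 - q ^ b))
        rwa [div_le_iff₀' (by linarith)] at this
      have h5 := mul_le_mul_of_nonneg_left ihk h0.le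
      linarith

theorem BoundedFamily.eq_zero_of_recOp_singleton (hq : 1 < q) {b : ℤ} (hb : 0 < b) {u : ℕ → ℝ}
    (hu : BoundedFamily u) (h : _root_.recOp q {b} u = 0) : u = 0 := by
  have h0 : u 0 = 0 := by
    by_contra h0
    obtain ⟨B, hB⟩ := hu
    obtain ⟨k, hk⟩ := pow_unbounded_of_one_lt (B / |u 0|) (one_lt_zpow₀ hq hb)
    have h1 := hB k
    rw [eq_pow_mul_of_recOp_singleton h, abs_mul, abs_of_pos (by positivity)] at h1
    rw [div_lt_iff₀ (abs_pos.2 h0)] at hk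
    linarith
  funext k
  rw [eq_pow_mul_of_recOp_singleton h, h0]
  simp

theorem BoundedFamily.recOp_zero_eq_zero {u : ℕ → ℝ} (hu : BoundedFamily u)
    (h : _root_.recOp q {0} (_root_.recOp q {0} u) = 0) : _root_.recOp q {0} u = 0 := by
  set d := _root_.recOp q {0} u 0
  have h1 : ∀ k, _root_.recOp q {0} u k = d := fun k => by
    rw [eq_pow_mul_of_recOp_singleton h]
    simp [d]
  have h2 : ∀ k : ℕ, u k = u 0 + k * d := fun k => by
    induction k with
    | zero => simp
    | succ k ih =>
      have := h1 k
      rw [recOp_singleton_apply, zpow_zero, one_mul, ih] at this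
      push_cast
      linarith
  have hd : d = 0 := by
    by_contra hd
    obtain ⟨B, hB⟩ := hu
    obtain ⟨k, hk⟩ := exists_nat_gt ((B + |u 0|) / |d|)
    rw [div_lt_iff₀ (abs_pos.2 hd)] at hk
    have h3 := hB k
    have h4 := abs_sub_abs_le_abs_sub (k * d) (-u 0)
    rw [abs_mul, Nat.abs_cast, abs_neg, sub_neg_eq_add, add_comm (k * d), ← h2 k] at h4
    linarith
  funext k
  rw [h1, hd]
  rfl

/-- The class of bounded families. Its permitted roots are `1`, simple, and all `q ^ b` with
`b < 0`. -/
noncomputable def boundedClass (hq : 1 < q) : GrowthClass q where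
  Mem := BoundedFamily
  comp := fun φ _ ⟨B, hB⟩ => ⟨B, fun j => hB (φ j)⟩
  of_cover := by
    intro I J _ K f φ hφ h
    choose B hB using h
    obtain ⟨C, hC⟩ := Set.finite_range B |>.bddAbove
    refine ⟨C, fun i => ?_⟩
    obtain ⟨j, k, rfl⟩ := hφ i
    exact (hB j k).trans (hC ⟨j, rfl⟩)
  mem_of_finite := by
    intro I _ f
    obtain ⟨C, hC⟩ := Set.finite_range (fun i => |f i|) |>.bddAbove
    exact ⟨C, fun i => hC ⟨i, rfl⟩⟩
  roots D := 0 ::ₘ (allRoots D).filter (· < 0)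
  recOp_eq_zero := by
    intro D u hu hb
    have hP : ∀ b u, BoundedFamily u → BoundedFamily (recOp q {b} u) := by
      rintro b u ⟨B, hB⟩
      refine ⟨B + |q ^ b| * B, fun k => ?_⟩
      rw [recOp_singleton_apply]
      refine (abs_sub _ _).trans (add_le_add (hB _) ?_)
      rw [abs_mul]
      exact mul_le_mul_of_nonneg_left (hB k) (abs_nonneg _)
    have h1 := recOp_allRoots_eq_zero hu
    have h2 : allRoots D = ((allRoots D).filter (· < 0) + Multiset.replicate (D + 1) 0) +
        (allRoots D).filter (0 < ·) := by
      ext b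
      rw [Multiset.count_add, Multiset.count_add, Multiset.count_filter, Multiset.count_filter,
        Multiset.count_replicate]
      rcases lt_trichotomy b 0 with h | rfl | h
      · simp [h, h.not_gt, h.ne']
      · rw [count_allRoots (by simp)]
        simp
      · simp [h, h.not_gt, h.ne]
    rw [h2] at h1
    have h3 := recOp_cancel hP (fun b hb u hu => hu.eq_zero_of_recOp_singleton hq
      (by simpa using (Multiset.mem_filter.1 hb).2)) hb h1
    clear h1 h2
    generalize (allRoots D).filter (· < 0) = s at h3
    generalize D = n at h3
    induction n with
    | zero => rwa [zero_add, Multiset.replicate_one, add_comm, Multiset.singleton_add] at h3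
    | succ n ih =>
      refine ih ?_
      rw [Multiset.replicate_succ, Multiset.replicate_succ, Multiset.add_cons, Multiset.add_cons,
        recOp_cons', recOp_cons'] at h3
      rw [Multiset.replicate_succ, Multiset.add_cons, recOp_cons']
      exact (recOp_induction hP _ hb).recOp_zero_eq_zero h3
  mem_of_recOp := by
    intro D I h hr hh
    have h1 : ∃ B, ∀ i k, |recOp q ((allRoots D).filter (· < 0)) (h i) k| ≤ B := by
      obtain ⟨B, hB⟩ := BoundedFamily.recOp (q := q) ((allRoots D).filter (· < 0)) hh 0
      refine ⟨B, fun i k => ?_⟩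
      have h2 := hr i
      rw [recOp_cons'] at h2
      rw [eq_pow_mul_of_recOp_singleton h2, zpow_zero, one_pow, one_mul]
      exact hB i
    obtain ⟨B, hB⟩ := BoundedFamily.of_recOp hq (fun b hb => (Multiset.mem_filter.1 hb).2) hh h1
    exact ⟨B, fun p => hB p.2 p.1⟩

/-- A family of real numbers is absolutely summable. -/
def SummableFamily {I : Type} (f : I → ℝ) : Prop := Summable fun i => |f i|

theorem SummableFamily.recOp_singleton {I : Type} {f g : I → ℝ} (c : ℝ) (hf : SummableFamily f)
    (hg : SummableFamily g) : SummableFamily fun i => g i - c * f i := by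
  refine Summable.of_nonneg_of_le (fun _ => abs_nonneg _) (fun i => ?_) (hg.add (hf.mul_left |c|))
  refine (abs_sub _ _).trans (add_le_add le_rfl ?_)
  rw [abs_mul]

/-- A contracting recurrence with summable right-hand side and summable initial values has summable
solutions. -/
theorem SummableFamily.of_recOp (hq : 1 < q) {I : Type} {h : I → ℕ → ℝ} {s : Multiset ℤ}
    (hs : ∀ b ∈ s, b < 0) (hh : ∀ k, SummableFamily fun i => h i k)
    (hr : SummableFamily fun p : ℕ × I => recOp q s (h p.2) p.1) :
    SummableFamily fun p : ℕ × I => h p.2 p.1 := by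
  induction s using Multiset.induction generalizing h with
  | empty => simpa using hr
  | cons b s ih =>
    simp only [recOp_cons] at hr
    have hv := ih (h := fun i => recOp q {b} (h i)) (fun b hb => hs b (Multiset.mem_cons_of_mem hb))
      (fun k => by
        simp only [recOp_singleton_apply]
        exact SummableFamily.recOp_singleton (f := fun i => h i k) (g := fun i => h i (k + 1)) _
          (hh k) (hh (k + 1))) hr
    obtain ⟨h0, h1⟩ := zpow_pos_lt_one hq (hs b (Multiset.mem_cons_self b s))
    -- Summing `|h (k + 1)| ≤ q ^ b |h k| + |v k|` over `k`, where `v` is the image of `h` under the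
    -- factor `E - q ^ b`, bounds the partial sums of `|h|`.
    have key : ∀ i N, (1 - q ^ b) * ∑ k ∈ Finset.range N, |h i k| ≤
        |h i 0| + ∑ k ∈ Finset.range N, |recOp q {b} (h i) k| := fun i N => by
      have h2 : ∑ k ∈ Finset.range N, |h i (k + 1)| ≤ ∑ k ∈ Finset.range N,
          (q ^ b * |h i k| + |recOp q {b} (h i) k|) := Finset.sum_le_sum fun k _ => by
        rw [recOp_singleton_apply]
        have := abs_sub_abs_le_abs_sub (h i (k + 1)) (q ^ b * h i k)
        rw [abs_mul, abs_of_pos h0] at this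
        linarith
      rw [Finset.sum_add_distrib, ← Finset.mul_sum] at h2
      have h3 := Finset.sum_range_succ' (fun k => |h i k|) N
      have h4 := Finset.sum_range_succ (fun k => |h i k|) N
      have h5 := abs_nonneg (h i N)
      linarith
    unfold SummableFamily
    refine summable_of_sum_le (c := (∑' i, |h i 0| +
      ∑' p : ℕ × I, |recOp q {b} (h p.2) p.1|) / (1 - q ^ b)) (fun _ => abs_nonneg _) fun T => ?_
    classical
    let U := T.image Prod.snd
    obtain ⟨N, hN⟩ := (T.image Prod.fst).exists_nat_subset_range
    have hT : T ⊆ Finset.range N ×ˢ U := fun p hp => Finset.mem_product.2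
      ⟨hN (Finset.mem_image_of_mem _ hp), Finset.mem_image_of_mem _ hp⟩
    refine (Finset.sum_le_sum_of_subset_of_nonneg hT fun _ _ _ => abs_nonneg _).trans ?_
    rw [le_div_iff₀' (by linarith), Finset.sum_product_right, Finset.mul_sum]
    refine (Finset.sum_le_sum fun i _ => key i N).trans ?_
    rw [Finset.sum_add_distrib]
    refine add_le_add ((hh 0).sum_le_tsum _ fun _ _ => abs_nonneg _) ?_
    rw [← Finset.sum_product_right (Finset.range N) U (fun p : ℕ × I => |recOp q {b} (h p.2) p.1|)]
    exact hv.sum_le_tsum _ fun _ _ => abs_nonneg _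

theorem SummableFamily.eq_zero_of_recOp_singleton (hq : 1 < q) {b : ℤ} (hb : 0 ≤ b) {u : ℕ → ℝ}
    (hu : SummableFamily u) (h : recOp q {b} u = 0) : u = 0 := by
  have h1 : ∀ k, |u 0| ≤ |u k| := fun k => by
    rw [eq_pow_mul_of_recOp_singleton h k, abs_mul]
    refine le_mul_of_one_le_left (abs_nonneg _) ?_
    rw [abs_of_pos (by positivity)]
    exact one_le_pow₀ (one_le_zpow₀ hq.le hb)
  have h0 : |u 0| ≤ 0 := ge_of_tendsto' hu.tendsto_atTop_zero h1
  funext k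
  rw [eq_pow_mul_of_recOp_singleton h, abs_nonpos_iff.1 h0]
  simp

/-- The class of absolutely summable families. Its permitted roots are all `q ^ b` with
`b < 0`. -/
noncomputable def summableClass (hq : 1 < q) : GrowthClass q where
  Mem := SummableFamily
  comp := fun _ hφ h => h.comp_injective hφ
  of_cover := by
    intro I J _ K f φ hφ h
    have h1 : Summable fun p : Σ j, K j => |f (φ p.1 p.2)| := by
      have := Fintype.ofFinite J
      rw [summable_sigma_of_nonneg fun _ => abs_nonneg _]
      exact ⟨h, (hasSum_fintype _).summable⟩
    choose j k hjk using hφ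
    have h2 := h1.comp_injective (i := fun i => (⟨j i, k i⟩ : Σ j, K j)) fun i i' hii => by
      rw [← hjk i, ← hjk i']
      exact congrArg (fun p : Σ j, K j => φ p.1 p.2) hii
    refine h2.congr fun i => ?_
    simp [hjk]
  mem_of_finite _ := (Summable.of_finite : Summable _)
  roots D := (allRoots D).filter (· < 0)
  recOp_eq_zero := by
    intro D u hu hb
    have hP : ∀ b u, SummableFamily u → SummableFamily (recOp q {b} u) := by
      intro b u hu
      have h1 : SummableFamily fun k => u (k + 1) := hu.comp_injective (add_left_injective 1)
      have h2 := hu.recOp_singleton (q ^ b) h1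
      simpa only [← recOp_singleton_apply] using h2
    refine recOp_cancel hP (t := (allRoots D).filter (¬ · < 0)) (fun b hb u hu =>
      hu.eq_zero_of_recOp_singleton hq (by simpa using (Multiset.mem_filter.1 hb).2)) hb ?_
    rw [Multiset.filter_add_not]
    exact recOp_allRoots_eq_zero hu
  mem_of_recOp := by
    intro D I h hr hh
    refine SummableFamily.of_recOp hq (s := (allRoots D).filter (· < 0))
      (fun b hb => (Multiset.mem_filter.1 hb).2) hh ?_
    simp only [hr]
    simp [SummableFamily, summable_zero]

end Growth

/-! ### Constructible functions are piecewise exponential polynomials along lines -/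

section Pieces

variable {ι : Type*} {q : ℝ}

/-- The group of directions of a subset of `ℤ^ι`, generated by the differences of its points. -/
def directions (L : Set (ι → ℤ)) : AddSubgroup (ι → ℤ) := AddSubgroup.closure (L - L)

theorem directions_mono {L L' : Set (ι → ℤ)} (h : L ⊆ L') : directions L ≤ directions L' :=
  AddSubgroup.closure_mono (Set.sub_subset_sub h h)

theorem sub_mem_directions {L : Set (ι → ℤ)} {x y : ι → ℤ} (hx : x ∈ L) (hy : y ∈ L) :
    x - y ∈ directions L :=
  AddSubgroup.subset_closure (Set.sub_mem_sub hx hy)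

/-- The extension of a function on `A ⊆ ℤ^ι` by zero, with real values. -/
noncomputable def extendZero {A : Set (ι → ℤ)} (f : A → coeffRing q) : (ι → ℤ) → ℝ :=
  Function.extend Subtype.val (fun a => (f a : ℝ)) 0

theorem extendZero_apply {A : Set (ι → ℤ)} (f : A → coeffRing q) {x : ι → ℤ} (hx : x ∈ A) :
    extendZero f x = f ⟨x, hx⟩ :=
  Subtype.val_injective.extend_apply (fun a => (f a : ℝ)) 0 ⟨x, hx⟩

/-- On the set `L`, the function `F` is an exponential polynomial along each line whose direction
`w` lies in the group of directions of `L`, of an order depending only on `w`. The line is only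
required to meet `L` in some set of points. -/
def IsExpPolyOn (q : ℝ) (F : (ι → ℤ) → ℝ) (L : Set (ι → ℤ)) : Prop :=
  ∀ w ∈ directions L, ∃ D, ∀ x ∈ L, ∃ u ∈ expPoly q D, ∀ k : ℕ, x + k • w ∈ L → F (x + k • w) = u k

theorem IsExpPolyOn.mono {F : (ι → ℤ) → ℝ} {L L' : Set (ι → ℤ)} (hF : IsExpPolyOn q F L)
    (h : L' ⊆ L) : IsExpPolyOn q F L' := fun w hw => by
  obtain ⟨D, hD⟩ := hF w (directions_mono h hw)
  refine ⟨D, fun x hx => ?_⟩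
  obtain ⟨u, hu, hux⟩ := hD x (h hx)
  exact ⟨u, hu, fun k hk => hux k (h hk)⟩

theorem IsExpPolyOn.congr {F G : (ι → ℤ) → ℝ} {L : Set (ι → ℤ)} (hF : IsExpPolyOn q F L)
    (h : EqOn F G L) : IsExpPolyOn q G L := fun w hw => by
  obtain ⟨D, hD⟩ := hF w hw
  refine ⟨D, fun x hx => ?_⟩
  obtain ⟨u, hu, hux⟩ := hD x hx
  exact ⟨u, hu, fun k hk => (h hk).symm.trans (hux k hk)⟩

theorem IsExpPolyOn.const (c : ℝ) (L : Set (ι → ℤ)) : IsExpPolyOn q (fun _ => c) L :=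
  fun _ _ => ⟨0, fun _ _ => ⟨_, const_mem_expPoly c, fun _ _ => rfl⟩⟩

theorem IsExpPolyOn.add {F G : (ι → ℤ) → ℝ} {L : Set (ι → ℤ)} (hF : IsExpPolyOn q F L)
    (hG : IsExpPolyOn q G L) : IsExpPolyOn q (F + G) L := fun w hw => by
  obtain ⟨D, hD⟩ := hF w hw
  obtain ⟨E, hE⟩ := hG w hw
  refine ⟨D + E, fun x hx => ?_⟩
  obtain ⟨u, hu, hux⟩ := hD x hx
  obtain ⟨v, hv, hvx⟩ := hE x hx
  exact ⟨u + v, add_mem (expPoly_mono (by omega) hu) (expPoly_mono (by omega) hv),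
    fun k hk => by
      rw [Pi.add_apply, hux k hk, hvx k hk]
      rfl⟩

theorem IsExpPolyOn.mul (hq : q ≠ 0) {F G : (ι → ℤ) → ℝ} {L : Set (ι → ℤ)}
    (hF : IsExpPolyOn q F L) (hG : IsExpPolyOn q G L) : IsExpPolyOn q (F * G) L := fun w hw => by
  obtain ⟨D, hD⟩ := hF w hw
  obtain ⟨E, hE⟩ := hG w hw
  refine ⟨D + E, fun x hx => ?_⟩
  obtain ⟨u, hu, hux⟩ := hD x hx
  obtain ⟨v, hv, hvx⟩ := hE x hx
  exact ⟨u * v, mul_mem_expPoly hq hu hv, fun k hk => by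
      rw [Pi.mul_apply, hux k hk, hvx k hk]
      rfl⟩

/-- If a linear set lies in the graph of `α`, then `α` is affine along lines in its projection. -/
theorem affine_of_isLinearSet_graph {A : Set (ι → ℤ)} {α : A → ℤ} {G : Set (ι ⊕ Fin 1 → ℤ)}
    (hG : IsLinearSet G) (hGα : G ⊆ graph α) {w : ι → ℤ}
    (hw : w ∈ directions ((· ∘ Sum.inl) '' G)) :
    ∃ c : ℤ, ∀ (x : ι → ℤ) (hx : x ∈ A) (k : ℕ) (hk : x + k • w ∈ A), x ∈ (· ∘ Sum.inl) '' G →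
      x + k • w ∈ (· ∘ Sum.inl) '' G → α ⟨x + k • w, hk⟩ = α ⟨x, hx⟩ + k * c := by
  obtain ⟨a, t, -, rfl⟩ := hG
  have key : ∃ p ∈ AddSubmonoid.closure t, ∃ p' ∈ AddSubmonoid.closure t, w = (p - p') ∘ Sum.inl := by
    unfold directions at hw
    induction hw using AddSubgroup.closure_induction with
    | mem w hw =>
      obtain ⟨_, ⟨_, ⟨p, hp, rfl⟩, rfl⟩, _, ⟨_, ⟨p', hp', rfl⟩, rfl⟩, rfl⟩ := hw
      exact ⟨p, hp, p', hp', by funext i; simp⟩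
    | zero => exact ⟨0, zero_mem _, 0, zero_mem _, by funext i; simp⟩
    | add w₁ w₂ _ _ h₁ h₂ =>
      obtain ⟨p₁, hp₁, p₁', hp₁', rfl⟩ := h₁
      obtain ⟨p₂, hp₂, p₂', hp₂', rfl⟩ := h₂
      exact ⟨_, add_mem hp₁ hp₂, _, add_mem hp₁' hp₂', by funext i; simp; ring⟩
    | neg w _ h =>
      obtain ⟨p, hp, p', hp', rfl⟩ := h
      exact ⟨p', hp', p, hp, by funext i; simp⟩
  obtain ⟨p, hp, p', hp', rfl⟩ := key
  refine ⟨p (Sum.inr 0) - p' (Sum.inr 0), ?_⟩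
  rintro x hx k hk ⟨_, ⟨r, hr, rfl⟩, hxr⟩ ⟨_, ⟨r', hr', rfl⟩, hkr⟩
  simp only [vadd_eq_add] at hxr hkr
  have hval : ∀ z ∈ a +ᵥ (AddSubmonoid.closure t : Set (ι ⊕ Fin 1 → ℤ)), ∀ hz : z ∘ Sum.inl ∈ A,
      z (Sum.inr 0) = α ⟨_, hz⟩ := fun z hz hzA => (mem_graph_iff.1 (hGα hz)).2
  have hval' : ∀ z ∈ a +ᵥ (AddSubmonoid.closure t : Set (ι ⊕ Fin 1 → ℤ)), ∀ y (hy : y ∈ A),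
      z ∘ Sum.inl = y → z (Sum.inr 0) = α ⟨y, hy⟩ := by
    rintro z hz y hy rfl
    exact hval z hz hy
  have h1 := hval' _ (vadd_mem_vadd_set hr) x hx hxr
  have h2 := hval' _ (vadd_mem_vadd_set hr') _ hk hkr
  -- Two points of the linear set with the same projection have the same last coordinate.
  have hz₁ : a +ᵥ (r + k • p) ∈ a +ᵥ (AddSubmonoid.closure t : Set (ι ⊕ Fin 1 → ℤ)) :=
    vadd_mem_vadd_set (add_mem hr (nsmul_mem hp k))
  have hz₂ : a +ᵥ (r' + k • p') ∈ a +ᵥ (AddSubmonoid.closure t : Set (ι ⊕ Fin 1 → ℤ)) :=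
    vadd_mem_vadd_set (add_mem hr' (nsmul_mem hp' k))
  have h3 : (a +ᵥ (r + k • p)) ∘ Sum.inl = (a +ᵥ (r' + k • p')) ∘ Sum.inl := by
    funext i
    have h4 := congrFun hxr i
    have h5 := congrFun hkr i
    simp only [vadd_eq_add, Function.comp_apply, Pi.add_apply, Pi.smul_apply, Pi.sub_apply,
      Int.nsmul_eq_mul] at h4 h5 ⊢
    linear_combination h4 - h5
  obtain ⟨hA₁, h6⟩ := mem_graph_iff.1 (hGα hz₁)
  have h7 := hval' _ hz₂ _ hA₁ h3.symm
  rw [← h2, ← h1]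
  simp only [vadd_eq_add, Pi.add_apply, Pi.smul_apply, Int.nsmul_eq_mul] at h6 h7 ⊢
  linear_combination h7 - h6

/-- `A` is a finite union of semilinear pieces on which `F` is an exponential polynomial along
lines. -/
def IsPiecewiseExpPoly (q : ℝ) (A : Set (ι → ℤ)) (F : (ι → ℤ) → ℝ) : Prop :=
  ∃ 𝓛 : Set (Set (ι → ℤ)), 𝓛.Finite ∧ (∀ L ∈ 𝓛, IsSemilinearSet L ∧ IsExpPolyOn q F L) ∧ A = ⋃₀ 𝓛

theorem IsPiecewiseExpPoly.congr {A : Set (ι → ℤ)} {F G : (ι → ℤ) → ℝ}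
    (hF : IsPiecewiseExpPoly q A F) (h : EqOn F G A) : IsPiecewiseExpPoly q A G := by
  obtain ⟨𝓛, hfin, h𝓛, rfl⟩ := hF
  exact ⟨𝓛, hfin, fun L hL => ⟨(h𝓛 L hL).1, (h𝓛 L hL).2.congr (h.mono (subset_sUnion_of_mem hL))⟩,
    rfl⟩

theorem IsPiecewiseExpPoly.map₂ {A : Set (ι → ℤ)} {F G H : (ι → ℤ) → ℝ}
    (hF : IsPiecewiseExpPoly q A F) (hG : IsPiecewiseExpPoly q A G)
    (hH : ∀ L, IsExpPolyOn q F L → IsExpPolyOn q G L → IsExpPolyOn q H L) :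
    IsPiecewiseExpPoly q A H := by
  obtain ⟨𝓛, hfin, h𝓛, hA⟩ := hF
  obtain ⟨𝓜, hfin', h𝓜, hA'⟩ := hG
  refine ⟨image2 (· ∩ ·) 𝓛 𝓜, hfin.image2 _ hfin', ?_, ?_⟩
  · rintro _ ⟨L, hL, M, hM, rfl⟩
    exact ⟨(h𝓛 L hL).1.inter (h𝓜 M hM).1, hH _ ((h𝓛 L hL).2.mono inter_subset_left)
      ((h𝓜 M hM).2.mono inter_subset_right)⟩
  · refine Subset.antisymm (fun x hx => ?_) ?_
    · obtain ⟨L, hL, hxL⟩ := hA ▸ hx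
      obtain ⟨M, hM, hxM⟩ := hA' ▸ hx
      exact ⟨_, ⟨L, hL, M, hM, rfl⟩, hxL, hxM⟩
    · rintro x ⟨_, ⟨L, hL, M, hM, rfl⟩, hx⟩
      rw [hA]
      exact ⟨L, hL, hx.1⟩

variable [Fintype ι] {A : Set (ι → ℤ)}

/-- A Presburger function is piecewise affine along lines. -/
theorem exists_affine_pieces {α : A → ℤ} (hα : IsPresburgerFun α) :
    ∃ 𝓛 : Set (Set (ι → ℤ)), 𝓛.Finite ∧ A = ⋃₀ 𝓛 ∧ ∀ L ∈ 𝓛, IsSemilinearSet L ∧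
      ∀ w ∈ directions L, ∃ c : ℤ, ∀ (x : ι → ℤ) (hx : x ∈ A) (k : ℕ) (hk : x + k • w ∈ A), x ∈ L →
      x + k • w ∈ L → α ⟨x + k • w, hk⟩ = α ⟨x, hx⟩ + k * c := by
  rw [isPresburgerFun_iff] at hα
  obtain ⟨𝓖, hfin, h𝓖, hG⟩ := hα
  refine ⟨(fun G => (· ∘ Sum.inl) '' G) '' 𝓖, hfin.image _, ?_, ?_⟩
  · ext x
    constructor
    · intro hx
      have : Sum.elim x (fun _ => α ⟨x, hx⟩) ∈ graph α := ⟨⟨x, hx⟩, rfl⟩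
      rw [hG] at this
      obtain ⟨G, hGm, hxG⟩ := this
      exact ⟨_, ⟨G, hGm, rfl⟩, _, hxG, by simp⟩
    · rintro ⟨_, ⟨G, hGm, rfl⟩, z, hz, rfl⟩
      have : z ∈ graph α := by
        rw [hG]
        exact ⟨G, hGm, hz⟩
      exact (mem_graph_iff.1 this).1
  · rintro _ ⟨G, hGm, rfl⟩
    refine ⟨((h𝓖 G hGm).image (LinearMap.funLeft ℤ ℤ Sum.inl)).isSemilinearSet, fun w hw => ?_⟩
    exact affine_of_isLinearSet_graph (h𝓖 G hGm) (hG ▸ subset_sUnion_of_mem hGm) hw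

theorem isPiecewiseExpPoly_extendZero (hq : q ≠ 0) (hA : IsSemilinearSet A)
    {f : A → coeffRing q} (hf : f ∈ constructible q A) :
    IsPiecewiseExpPoly q A (extendZero f) := by
  induction hf using Algebra.adjoin_induction with
  | mem f hf =>
    rcases hf with ⟨α, hα, rfl⟩ | ⟨α, hα, rfl⟩
    · obtain ⟨𝓛, hfin, hA, h𝓛⟩ := exists_affine_pieces hα
      refine ⟨𝓛, hfin, fun L hL => ⟨(h𝓛 L hL).1, fun w hw => ⟨1, fun x hx => ?_⟩⟩, hA⟩
      obtain ⟨c, hc⟩ := (h𝓛 L hL).2 w hw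
      have hxA : x ∈ A := hA ▸ ⟨L, hL, hx⟩
      refine ⟨_, affine_mem_expPoly (α ⟨x, hxA⟩) c, fun k hk => ?_⟩
      have hkA : x + k • w ∈ A := by rw [hA]; exact ⟨L, hL, hk⟩
      rw [extendZero_apply _ hkA, hc x hxA k hkA hx hk]
      push_cast
      rfl
    · obtain ⟨𝓛, hfin, hA, h𝓛⟩ := exists_affine_pieces hα
      refine ⟨𝓛, hfin, fun L hL => ⟨(h𝓛 L hL).1, fun w hw => ?_⟩, hA⟩
      obtain ⟨c, hc⟩ := (h𝓛 L hL).2 w hw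
      refine ⟨c.natAbs, fun x hx => ?_⟩
      have hxA : x ∈ A := hA ▸ ⟨L, hL, hx⟩
      refine ⟨_, geometric_mem_expPoly (q ^ α ⟨x, hxA⟩) c, fun k hk => ?_⟩
      have hkA : x + k • w ∈ A := by rw [hA]; exact ⟨L, hL, hk⟩
      rw [extendZero_apply _ hkA, hc x hxA k hkA hx hk]
      change q ^ _ = _
      rw [zpow_add₀ hq, mul_comm (k : ℤ), zpow_mul, zpow_natCast]
  | algebraMap r =>
    refine IsPiecewiseExpPoly.congr (F := fun _ => (r : ℝ)) ⟨{A}, finite_singleton A, ?_, by simp⟩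
      fun x hx => by rw [extendZero_apply _ hx]; rfl
    rintro L rfl
    exact ⟨hA, .const _ _⟩
  | add f g _ _ hf hg =>
    refine (hf.map₂ hg (H := extendZero f + extendZero g) fun L h h' => h.add h').congr
      fun x hx => ?_
    simp [extendZero_apply _ hx]
  | mul f g _ _ hf hg =>
    refine (hf.map₂ hg (H := extendZero f * extendZero g) fun L h h' => h.mul hq h').congr
      fun x hx => ?_
    simp [extendZero_apply _ hx]

/-- A constructible function is an exponential polynomial along lines on each piece of a
suitable finite cover of its domain by proper linear sets. -/
theorem exists_properLinear_pieces (hq : q ≠ 0) (hA : IsSemilinearSet A)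
    {f : A → coeffRing q} (hf : f ∈ constructible q A) :
    ∃ 𝓛 : Set (Set (ι → ℤ)), 𝓛.Finite ∧ A = ⋃₀ 𝓛 ∧
      ∀ L ∈ 𝓛, IsProperLinearSet L ∧ IsExpPolyOn q (extendZero f) L := by
  obtain ⟨𝓛, hfin, h𝓛, hA'⟩ := isPiecewiseExpPoly_extendZero hq hA hf
  choose! 𝓜 h𝓜 using fun L hL => (h𝓛 L hL).1.isProperSemilinearSet
  refine ⟨⋃ L ∈ 𝓛, 𝓜 L, hfin.biUnion fun L hL => (h𝓜 L hL).1, ?_, ?_⟩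
  · simp_rw [sUnion_iUnion]
    rw [hA', sUnion_eq_biUnion]
    exact iUnion₂_congr fun L hL => (h𝓜 L hL).2.2
  · intro M hM
    obtain ⟨L, hL, hM⟩ := mem_iUnion₂.1 hM
    refine ⟨(h𝓜 L hL).2.1 M hM, (h𝓛 L hL).2.mono ?_⟩
    rw [(h𝓜 L hL).2.2]
    exact subset_sUnion_of_mem hM

end Pieces

/-! ### Loci of identical vanishing -/

section Vanishing

variable {ι κ : Type*}

/-- The directions of a linear set are integral combinations of its periods. -/
theorem exists_eq_sum_of_mem_directions {L : Set (ι → ℤ)} {a : ι → ℤ} {k : ℕ}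
    {v : Fin k → ι → ℤ} (hmem : ∀ x, x ∈ L ↔ ∃ n : Fin k → ℕ, x = a + ∑ j, n j • v j)
    {w : ι → ℤ} (hw : w ∈ directions L) : ∃ c : Fin k → ℤ, w = ∑ j, c j • v j := by
  unfold directions at hw
  induction hw using AddSubgroup.closure_induction with
  | mem w hw =>
    obtain ⟨x, hx, y, hy, rfl⟩ := hw
    obtain ⟨n, rfl⟩ := (hmem x).1 hx
    obtain ⟨n', rfl⟩ := (hmem y).1 hy
    exact ⟨fun j => n j - n' j, by simp [sub_smul]⟩
  | zero => exact ⟨0, by simp⟩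
  | add w₁ w₂ _ _ h₁ h₂ =>
    obtain ⟨c₁, rfl⟩ := h₁
    obtain ⟨c₂, rfl⟩ := h₂
    exact ⟨c₁ + c₂, by simp [add_smul, Finset.sum_add_distrib]⟩
  | neg w _ h =>
    obtain ⟨c, rfl⟩ := h
    exact ⟨-c, by simp⟩

/-- A proper linear set contains all intermediate points of an arithmetic progression between two
of its points, if the step is a direction of the set. -/
theorem add_nsmul_mem_of_add_nsmul_mem {L : Set (ι → ℤ)} (hL : IsProperLinearSet L) {w : ι → ℤ}
    (hw : w ∈ directions L) {x : ι → ℤ} (hx : x ∈ L) {t : ℕ} (hxt : x + t • w ∈ L) {j : ℕ}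
    (hj : j ≤ t) : x + j • w ∈ L := by
  obtain ⟨a, k, v, hv, hmem⟩ := hL.exists_linearIndependent
  obtain ⟨c, rfl⟩ := exists_eq_sum_of_mem_directions hmem hw
  obtain ⟨n, rfl⟩ := (hmem x).1 hx
  obtain ⟨n', hn'⟩ := (hmem _).1 hxt
  have h1 : ∀ i, (n i : ℤ) + t * c i = n' i := by
    have h2 : ∑ i, ((n i : ℤ) + t * c i - n' i) • v i = 0 := by
      simp only [sub_smul, add_smul, mul_smul, Finset.sum_sub_distrib, Finset.sum_add_distrib,
        ← Finset.smul_sum, natCast_zsmul]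
      rw [add_assoc] at hn'
      rw [add_left_cancel hn', sub_self]
    intro i
    have := Fintype.linearIndependent_iff.1 hv _ h2 i
    linarith
  have h3 : ∀ i, 0 ≤ (n i : ℤ) + j * c i := fun i => by
    rcases le_total 0 (c i) with h | h
    · positivity
    · have h4 : (t : ℤ) * c i ≤ j * c i := mul_le_mul_of_nonpos_right (by exact_mod_cast hj) h
      have := h1 i
      omega
  rw [hmem]
  refine ⟨fun i => ((n i : ℤ) + j * c i).toNat, ?_⟩
  rw [add_assoc]
  congr 1
  rw [Finset.smul_sum, ← Finset.sum_add_distrib]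
  refine Finset.sum_congr rfl fun i _ => ?_
  change n i • v i + j • c i • v i = ((n i : ℤ) + j * c i).toNat • v i
  rw [← natCast_zsmul (v i) (Int.toNat _), Int.toNat_of_nonneg (h3 i), add_smul, mul_smul, natCast_zsmul,
    natCast_zsmul]

/-- The fibres over `ℤ^ι` of a subset of `ℤ^ι × ℤ` lie in arithmetic progressions with a common
step, namely a generator of the cyclic group of vertical directions of the set. -/
theorem exists_vertical_direction {L : Set (ι ⊕ Fin 1 → ℤ)} :
    ∃ w ∈ directions L, w ∘ Sum.inl = 0 ∧ ∀ x ∈ L, ∀ x' ∈ L, x ∘ Sum.inl = x' ∘ Sum.inl →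
      ∃ z : ℤ, x' = x + z • w := by
  let r : (ι ⊕ Fin 1 → ℤ) →+ (ι → ℤ) := (LinearMap.funLeft ℤ ℤ Sum.inl).toAddMonoidHom
  let V : AddSubgroup (ι ⊕ Fin 1 → ℤ) := directions L ⊓ r.ker
  let p : V →+ ℤ := (Pi.evalAddMonoidHom (fun _ : ι ⊕ Fin 1 => ℤ) (Sum.inr 0)).comp V.subtype
  have hp : Function.Injective p := by
    rw [injective_iff_map_eq_zero]
    rintro ⟨x, hx⟩ h
    have hx' : r x = 0 := hx.2
    ext (i | i)
    · exact congrFun hx' i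
    · rw [Subsingleton.elim i 0]
      exact h
  obtain ⟨w, hw⟩ := (isAddCyclic_of_injective p hp).exists_generator
  refine ⟨w, w.2.1, w.2.2, fun x hx x' hx' h => ?_⟩
  have hV : x' - x ∈ V := ⟨sub_mem_directions hx' hx, by
    change (x' - x) ∘ Sum.inl = 0
    funext i
    have := congrFun h i
    simp only [Function.comp_apply] at this
    simp [this]⟩
  obtain ⟨z, hz⟩ := AddSubgroup.mem_zmultiples_iff.1 (hw ⟨_, hV⟩)
  refine ⟨z, ?_⟩
  have := congrArg Subtype.val hz
  simp only [AddSubgroup.coe_zsmul] at this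
  rw [this]
  abel

theorem isSemilinearSet_halfSpace [Fintype ι] (i j : ι) (a b c : ℤ) :
    IsSemilinearSet {x : ι → ℤ | 0 ≤ c + (a * x i + b * x j)} := by
  classical
  convert! (IsPresburgerSet.nonneg (Pi.single i a + Pi.single j b) c).isSemilinearSet using 1
  ext x
  simp [Pi.single_apply, add_mul, Finset.sum_add_distrib]

/-- Definable choice: a semilinear set in `ℤ^ι × ℤ` admits a section with semilinear graph. The
section picks the element of the fibre of least absolute value, preferring the negative one. -/
theorem IsSemilinearSet.exists_section [Fintype ι] {L : Set (ι ⊕ Fin 1 → ℤ)}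
    (hL : IsSemilinearSet L) : ∃ σ : (ι → ℤ) → ℤ,
      IsSemilinearSet {z : ι ⊕ Fin 1 → ℤ | z (Sum.inr 0) = σ (z ∘ Sum.inl)} ∧
      ∀ z ∈ L, Sum.elim (z ∘ Sum.inl) (fun _ => σ (z ∘ Sum.inl)) ∈ L := by
  classical
  let r : ℤ → ℤ → Prop := fun y' y => (-y ≤ y' ∧ y' < y) ∨ (y < y' ∧ y' < -y)
  let P : (ι → ℤ) → ℤ → Prop := fun s y => Sum.elim s (fun _ => y) ∈ L
  have hmin : ∀ s, (∃ y, P s y) → ∃ y, P s y ∧ ∀ y', P s y' → ¬ r y' y := fun s ⟨y, hy⟩ => by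
    -- `r` is the strict order `0, -1, 1, -2, 2, …` on `ℤ`, which is given by linear inequalities.
    have hwf : WellFounded r := Subrelation.wf (r := InvImage (· < ·) fun y : ℤ =>
      2 * y.natAbs + if 0 < y then 1 else 0) (by
        intro y' y h
        simp only [r] at h
        simp only [InvImage]
        split_ifs <;> omega) (InvImage.wf _ wellFounded_lt)
    obtain ⟨y₀, h₀, h₁⟩ := hwf.has_min {y | P s y} ⟨y, hy⟩
    exact ⟨y₀, h₀, fun y' hy' => h₁ y' hy'⟩
  choose! σ₀ hσ using hmin
  refine ⟨fun s => if ∃ y, P s y then σ₀ s else 0, ?_, fun z hz => ?_⟩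
  · have h1 : IsSemilinearSet {z : ι ⊕ Fin 1 → ℤ | ∃ y : Fin 1 → ℤ,
        Sum.elim z y ∈ {x : (ι ⊕ Fin 1) ⊕ Fin 1 → ℤ | x ∘ (Sum.elim (Sum.inl ∘ Sum.inl) Sum.inr) ∈ L}
        ∩ {x | r (x (Sum.inr 0)) (x (Sum.inl (Sum.inr 0)))}} := by
      refine ((hL.reindex _).inter ?_).proj
      convert! ((isSemilinearSet_halfSpace (Sum.inr 0) (Sum.inl (Sum.inr 0)) 1 1 0).inter
        (isSemilinearSet_halfSpace (Sum.inr 0) (Sum.inl (Sum.inr 0)) (-1) 1 (-1))).union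
        ((isSemilinearSet_halfSpace (Sum.inr 0) (Sum.inl (Sum.inr 0)) 1 (-1) (-1)).inter
        (isSemilinearSet_halfSpace (ι := (ι ⊕ Fin 1) ⊕ Fin 1) (Sum.inr 0) (Sum.inl (Sum.inr 0)) (-1)
          (-1) (-1))) using 1
      ext x
      simp only [r, mem_union, mem_inter_iff, mem_ofPred_eq]
      omega
    have h2 : IsSemilinearSet {z : ι ⊕ Fin 1 → ℤ | ∃ y : Fin 1 → ℤ,
        Sum.elim z y ∈ {x : (ι ⊕ Fin 1) ⊕ Fin 1 → ℤ |
          x ∘ (Sum.elim (Sum.inl ∘ Sum.inl) Sum.inr) ∈ L}} := (hL.reindex _).proj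
    have helim : ∀ (z : ι ⊕ Fin 1 → ℤ) (y : Fin 1 → ℤ),
        Sum.elim z y ∘ (Sum.elim (Sum.inl ∘ Sum.inl) Sum.inr) =
          Sum.elim (z ∘ Sum.inl) (fun _ => y 0) := fun z y => by
      funext i
      rcases i with i | i
      · rfl
      · rw [Subsingleton.elim i 0]
        rfl
    convert! (hL.inter h1.compl).union (h2.compl.inter (isSemilinearSet_apply_eq (Sum.inr 0) 0))
      using 1
    ext z
    have hz : z ∈ L ↔ P (z ∘ Sum.inl) (z (Sum.inr 0)) := by
      have : z = Sum.elim (z ∘ Sum.inl) (fun _ => z (Sum.inr 0)) := by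
        funext i
        rcases i with i | i
        · rfl
        · rw [Subsingleton.elim i 0]
          rfl
      conv_lhs => rw [this]
    simp only [mem_ofPred_eq, mem_union, mem_inter_iff, mem_compl_iff, helim, Sum.elim_inr,
      Sum.elim_inl, hz]
    change _ ↔ (_ ∧ ¬ ∃ y : Fin 1 → ℤ, P (z ∘ Sum.inl) (y 0) ∧ r (y 0) (z (Sum.inr 0))) ∨
      (¬ ∃ y : Fin 1 → ℤ, P (z ∘ Sum.inl) (y 0)) ∧ _
    have hfin : ∀ Q : ℤ → Prop, (∃ y : Fin 1 → ℤ, Q (y 0)) ↔ ∃ y, Q y := fun Q =>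
      ⟨fun ⟨y, hy⟩ => ⟨_, hy⟩, fun ⟨y, hy⟩ => ⟨fun _ => y, hy⟩⟩
    rw [hfin (P (z ∘ Sum.inl)), hfin fun y => P (z ∘ Sum.inl) y ∧ r y (z (Sum.inr 0))]
    by_cases h : ∃ y, P (z ∘ Sum.inl) y
    · simp only [h, if_true, not_true, false_and, or_false]
      obtain ⟨h3, h4⟩ := hσ _ h
      constructor
      · intro h5
        rw [h5]
        exact ⟨h3, fun ⟨y, hy, hy'⟩ => h4 y hy hy'⟩
      · rintro ⟨h5, h6⟩
        have h7 := h4 _ h5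
        have h8 : ¬ r (σ₀ (z ∘ Sum.inl)) (z (Sum.inr 0)) := fun h => h6 ⟨_, h3, h⟩
        simp only [r] at h7 h8
        omega
    · simp only [h, if_false, not_false_eq_true, true_and]
      have : ¬ P (z ∘ Sum.inl) (z (Sum.inr 0)) := fun h' => h ⟨_, h'⟩
      tauto
  · have hz' : ∃ y, P (z ∘ Sum.inl) y := ⟨z (Sum.inr 0), by
      convert! hz using 1
      funext i
      rcases i with i | i
      · rfl
      · rw [Subsingleton.elim i 0]
        rfl⟩
    simp only [hz', if_true]
    exact (hσ _ hz').1

/-- If an exponential polynomial along lines vanishes at the first points of a progression in `L`,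
then it vanishes on the whole progression. -/
theorem eq_zero_of_progression {q : ℝ} {F : (κ → ℤ) → ℝ} {L : Set (κ → ℤ)} {w : κ → ℤ} {D : ℕ}
    (hD : ∀ x ∈ L, ∃ u ∈ expPoly q D, ∀ k : ℕ, x + k • w ∈ L → F (x + k • w) = u k)
    {x : κ → ℤ} {t : ℕ} (hx : ∀ j ≤ t, x + j • w ∈ L)
    (h0 : ∀ j ≤ t, j < (allRoots D).card → F (x + j • w) = 0) : F (x + t • w) = 0 := by
  rcases lt_or_ge t (allRoots D).card with h | h
  · exact h0 t le_rfl h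
  · obtain ⟨u, hu, hux⟩ := hD x (by simpa using hx 0 (by omega))
    have : u = 0 := eq_zero_of_recOp_eq_zero (recOp_allRoots_eq_zero hu) fun k hk => by
      rw [← hux k (hx k (by omega)), h0 k (by omega) hk]
    rw [hux t (hx t le_rfl), this]
    rfl

variable [Fintype ι] [Fintype κ] {q : ℝ} {S : Set (ι → ℤ)} {A : Set (κ → ℤ)}

/-- A subset of `S` is a zero locus if it is the set of zeros of a constructible function. -/
def IsZeroLocus (q : ℝ) (Z : Set S) : Prop := ∃ h ∈ constructible q S, Z = zeroLocus h

/-- Zero loci are stable under finite intersections, by taking sums of squares. -/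
theorem IsZeroLocus.iInter {J : Type*} [Finite J] {Z : J → Set S} (hZ : ∀ j, IsZeroLocus q (Z j)) :
    IsZeroLocus q (⋂ j, Z j) := by
  have := Fintype.ofFinite J
  choose h hh hZ using hZ
  refine ⟨∑ j, h j * h j, sum_mem fun j _ => mul_mem (hh j) (hh j), ?_⟩
  ext s
  simp only [mem_iInter, hZ, zeroLocus, mem_ofPred_eq, Finset.sum_apply, Pi.mul_apply]
  rw [Finset.sum_eq_zero_iff_of_nonneg fun j _ => mul_self_nonneg _]
  simp

open Classical in
theorem isZeroLocus_of_map (hA : IsSemilinearSet A) {f : A → coeffRing q}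
    (hf : f ∈ constructible q A) {L : Set (κ → ℤ)} (hL : IsSemilinearSet L) {φ : S → A}
    (hφ : IsPresburgerMap φ) : IsZeroLocus q {s : S | (φ s : κ → ℤ) ∈ L → f (φ s) = 0} := by
  refine ⟨_, constructible_comp (mul_mem (indicator_mem_constructible hA hL) hf) hφ, ?_⟩
  ext s
  simp only [mem_ofPred_eq, zeroLocus, Function.comp_apply, Pi.mul_apply]
  split_ifs with h <;> simp [h]

theorem isPresburgerMap_section (hS : IsSemilinearSet S) {σ : (ι → ℤ) → ℤ}
    (hσ : IsSemilinearSet {z : ι ⊕ Fin 1 → ℤ | z (Sum.inr 0) = σ (z ∘ Sum.inl)}) (c : ℤ) :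
    IsPresburgerMap fun s : S => (pt s fun _ => σ s + c : prodInt S 1) := by
  classical
  unfold IsPresburgerMap
  have h1 : IsSemilinearSet {z : ι ⊕ (ι ⊕ Fin 1) → ℤ | ∀ i, z (Sum.inr (Sum.inl i)) =
      z (Sum.inl i)} := by
    rw [ofPred_forall]
    refine .iInter fun i => ?_
    convert! IsSemilinearSet.setOf_linForm_eq (Pi.single (Sum.inr (Sum.inl i)) 1 -
      Pi.single (Sum.inl i) 1 : ι ⊕ (ι ⊕ Fin 1) → ℤ) 0 using 1
    ext z
    simp [sub_mul, Finset.sum_sub_distrib, Pi.single_apply, sub_eq_zero]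
  have h2 := (hσ.preimage_add (Sum.elim (0 : ι → ℤ) fun _ => -c)).reindex
    (ι := ι ⊕ (ι ⊕ Fin 1)) Sum.inr
  convert! ((hS.reindex (ι := ι ⊕ (ι ⊕ Fin 1)) Sum.inl).inter h1).inter h2 using 1
  ext z
  simp only [mem_ofPred_eq, mem_inter_iff, exists_prop, and_assoc, pt]
  refine and_congr_right fun hz => ?_
  have h3 : ((z ∘ Sum.inr) + Sum.elim (0 : ι → ℤ) fun _ => -c) ∘ Sum.inl = z ∘ Sum.inr ∘ Sum.inl := by
    funext i
    simp
  rw [h3]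
  constructor
  · intro h
    have h4 : ∀ i, z (Sum.inr (Sum.inl i)) = z (Sum.inl i) := fun i => congrFun h (Sum.inl i)
    have h5 : z ∘ Sum.inr ∘ Sum.inl = z ∘ Sum.inl := funext h4
    have h6 := congrFun h (Sum.inr 0)
    refine ⟨h4, ?_⟩
    rw [h5]
    simp only [Function.comp_apply, Sum.elim_inr] at h6
    simp [h6]
  · rintro ⟨h4, h6⟩
    have h5 : z ∘ Sum.inr ∘ Sum.inl = z ∘ Sum.inl := funext h4
    rw [h5] at h6
    funext i
    rcases i with i | i
    · exact h4 i
    · rw [Subsingleton.elim i 0]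
      simp only [Pi.add_apply, Function.comp_apply, Sum.elim_inr] at h6 ⊢
      linarith

/-- The vanishing locus in one variable. On each proper linear piece, identical vanishing on a fibre
is tested at boundedly many points around a definably chosen point of the fibre. -/
theorem isZeroLocus_ivaLocus_one (hq : q ≠ 0) (hS : IsSemilinearSet S)
    {f : prodInt S 1 → coeffRing q} (hf : f ∈ constructible q (prodInt S 1)) :
    IsZeroLocus q (ivaLocus f) := by
  have hSm := isSemilinearSet_prodInt hS 1
  obtain ⟨𝓛, hfin, hcover, h𝓛⟩ := exists_properLinear_pieces hq hSm hf
  have : Finite 𝓛 := hfin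
  choose w hw hw0 hwz using fun L : 𝓛 => exists_vertical_direction (L := L.1)
  choose D hD using fun L : 𝓛 => (h𝓛 L L.2).2 (w L) (hw L)
  choose D' hD' using fun L : 𝓛 => (h𝓛 L L.2).2 (-w L) (neg_mem (hw L))
  choose σ hσ hσL using fun L : 𝓛 => (h𝓛 L L.2).1.isLinearSet.isSemilinearSet.exists_section
  let N : 𝓛 → ℕ := fun L => (allRoots (D L)).card + (allRoots (D' L)).card
  let φ : 𝓛 → ℤ → S → prodInt S 1 := fun L j s => pt s fun _ => σ L s + j * w L (Sum.inr 0)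
  have key : IsZeroLocus q (⋂ L : 𝓛, ⋂ j : Set.Icc (-(N L : ℤ)) (N L),
      {s : S | (φ L j s : ι ⊕ Fin 1 → ℤ) ∈ L.1 → f (φ L j s) = 0}) :=
    .iInter fun L => .iInter fun j => isZeroLocus_of_map hSm hf
      (h𝓛 L L.2).1.isLinearSet.isSemilinearSet (isPresburgerMap_section hS (hσ L) _)
  convert! key using 1
  ext s
  simp only [ivaLocus, mem_ofPred_eq, mem_iInter]
  constructor
  · intro h L j _
    exact h _
  · intro h y
    have hy : (pt s y : ι ⊕ Fin 1 → ℤ) ∈ ⋃₀ 𝓛 := hcover.subset (pt s y).2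
    obtain ⟨L', hL', hy⟩ := hy
    let L : 𝓛 := ⟨L', hL'⟩
    have hsL : (φ L 0 s : ι ⊕ Fin 1 → ℤ) ∈ L.1 := by
      simpa [φ, pt] using hσL L _ hy
    have hφ : ∀ j, (φ L j s : ι ⊕ Fin 1 → ℤ) = (φ L 0 s : ι ⊕ Fin 1 → ℤ) + j • w L := fun j => by
      funext i
      rcases i with i | i
      · have := congrFun (hw0 L) i
        simp only [Function.comp_apply, Pi.zero_apply] at this
        simp [φ, pt, this]
      · rw [Subsingleton.elim i 0]
        simp [φ, pt]
    have hzero : ∀ j : ℤ, -(N L : ℤ) ≤ j → j ≤ N L → (φ L 0 s : ι ⊕ Fin 1 → ℤ) + j • w L ∈ L.1 →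
        extendZero f ((φ L 0 s : ι ⊕ Fin 1 → ℤ) + j • w L) = 0 := fun j h1 h2 h3 => by
      rw [← hφ] at h3 ⊢
      rw [extendZero_apply _ (φ L j s).2]
      exact_mod_cast congrArg Subtype.val (h L ⟨j, h1, h2⟩ h3)
    obtain ⟨z, hz⟩ := hwz L _ hsL _ hy (by simp [φ, pt])
    suffices extendZero f (pt s y : ι ⊕ Fin 1 → ℤ) = 0 by
      rw [extendZero_apply _ (pt s y).2] at this
      exact_mod_cast this
    rw [hz] at hy ⊢
    obtain ⟨t, rfl | rfl⟩ := Int.eq_nat_or_neg z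
    · rw [natCast_zsmul] at hy ⊢
      have hmem := fun j hj => add_nsmul_mem_of_add_nsmul_mem (h𝓛 L L.2).1 (hw L) hsL hy (j := j) hj
      refine eq_zero_of_progression (hD L) hmem fun j hj hjD => ?_
      rw [← natCast_zsmul]
      exact hzero j (by omega) (by simp only [N]; omega) (by rw [natCast_zsmul]; exact hmem j hj)
    · rw [neg_smul, ← smul_neg, natCast_zsmul] at hy ⊢
      have hmem := fun j hj => add_nsmul_mem_of_add_nsmul_mem (h𝓛 L L.2).1 (neg_mem (hw L)) hsL hy
        (j := j) hj
      refine eq_zero_of_progression (hD' L) hmem fun j hj hjD => ?_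
      have h1 : j • (-w L) = (-(j : ℤ)) • w L := by rw [neg_smul, ← smul_neg, natCast_zsmul]
      rw [h1]
      exact hzero _ (by simp only [N]; omega) (by omega) (by rw [← h1]; exact hmem j hj)

/-- Loci of identical vanishing are zero loci. -/
theorem isZeroLocus_ivaLocus (hq : q ≠ 0) (hS : IsSemilinearSet S) {m : ℕ}
    {f : prodInt S m → coeffRing q} (hf : f ∈ constructible q (prodInt S m)) :
    IsZeroLocus q (ivaLocus f) := by
  induction m with
  | zero =>
    have hφ : IsPresburgerMap fun s : S => (pt s 0 : prodInt S 0) :=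
      isPresburgerMap_of_reindex hS (Sum.elim id Fin.elim0) 0 fun s => by
        funext i
        rcases i with i | i
        · simp [pt]
        · exact i.elim0
    refine ⟨_, constructible_comp hf hφ, ?_⟩
    ext s
    simp only [ivaLocus, zeroLocus, mem_ofPred_eq, Function.comp_apply]
    exact ⟨fun h => h 0, fun h y => by rwa [Subsingleton.elim y 0]⟩
  | succ m ih =>
    have hSm := isSemilinearSet_prodInt hS m
    let e : ι ⊕ Fin (m + 1) → (ι ⊕ Fin m) ⊕ Fin 1 :=
      Sum.elim (Sum.inl ∘ Sum.inl) (Fin.snoc (α := fun _ => (ι ⊕ Fin m) ⊕ Fin 1)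
        (Sum.inl ∘ Sum.inr) (Sum.inr 0))
    let φ : prodInt (prodInt S m) 1 → prodInt S (m + 1) := fun z => 
      ⟨(z : (ι ⊕ Fin m) ⊕ Fin 1 → ℤ) ∘ e, z.2⟩
    have hφ : IsPresburgerMap φ := isPresburgerMap_of_reindex (isSemilinearSet_prodInt hSm 1) e 0
      fun z => by simp [φ]
    obtain ⟨h, hh, hloc⟩ := isZeroLocus_ivaLocus_one hq hSm (constructible_comp hf hφ)
    obtain ⟨h', hh', hloc'⟩ := ih hh
    refine ⟨h', hh', ?_⟩
    rw [← hloc']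
    ext s
    simp only [ivaLocus, mem_ofPred_eq]
    have hpt : ∀ y : Fin (m + 1) → ℤ,
        φ (pt (pt s (Fin.init y)) fun _ => y (Fin.last m)) = pt s y := fun y => by
      apply Subtype.ext
      funext i
      rcases i with i | i
      · rfl
      · refine Fin.lastCases ?_ (fun i => ?_) i
        · simp [φ, e, pt]
        · simp [φ, e, pt, Fin.init]
    have hiff : ∀ x : prodInt S m, h x = 0 ↔ ∀ y, (f ∘ φ) (pt x y) = 0 := fun x =>
      (Set.ext_iff.1 hloc x).symm
    simp only [hiff, Function.comp_apply]
    constructor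
    · intro h1 y y'
      have h2 := hpt (Fin.snoc (α := fun _ => ℤ) y (y' 0))
      rw [Fin.init_snoc, Fin.snoc_last] at h2
      have h3 : (fun _ : Fin 1 => y' 0) = y' := funext fun i => by rw [Subsingleton.elim i 0]
      rw [h3] at h2
      rw [h2]
      exact h1 _
    · intro h1 y
      rw [← hpt y]
      exact h1 _ _

end Vanishing

/-! ### Loci of growth conditions -/

section Loci

/-- The fibres of a linear set over the first block of coordinates are finite unions of translates
of one finitely generated monoid of vertical vectors. -/
theorem IsLinearSet.exists_fibre_monoid {ι κ : Type*} {L : Set (ι ⊕ κ → ℤ)} (hL : IsLinearSet L) :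
    ∃ (r : ℕ) (w : Fin r → ι ⊕ κ → ℤ),
      (∀ j, w j ≠ 0 ∧ w j ∘ Sum.inl = 0 ∧ w j ∈ directions L ∧ ∀ x ∈ L, x + w j ∈ L) ∧
      ∀ s : ι → ℤ, ∃ T : Set (ι ⊕ κ → ℤ), T.Finite ∧ (∀ x ∈ T, x ∈ L ∧ x ∘ Sum.inl = s) ∧
        ∀ x ∈ L, x ∘ Sum.inl = s → ∃ μ ∈ T, ∃ k : Fin r → ℕ, x = μ + ∑ j, k j • w j := by
  classical
  rcases L.eq_empty_or_nonempty with rfl | ⟨x₀, hx₀⟩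
  · exact ⟨0, Fin.elim0, fun j => j.elim0, fun s => ⟨∅, finite_empty, by simp, by simp⟩⟩
  obtain ⟨a, n, g, rfl⟩ := isLinearSet_iff_exists_fin_addMonoidHom.1 hL
  let p : (ι ⊕ κ → ℤ) →+ (ι → ℤ) := (LinearMap.funLeft ℤ ℤ Sum.inl).toAddMonoidHom
  let M : AddSubmonoid (Fin n → ℕ) := AddMonoidHom.mker (p.comp g)
  have hM : ∀ x, x ∈ M ↔ p (g x) = 0 := fun x => Iff.rfl
  -- The vertical submonoid is subtractive, hence finitely generated.
  obtain ⟨t, ht⟩ : M.FG := AddSubmonoid.fg_of_subtractive fun x hx y hxy => by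
    rw [hM] at hx hxy ⊢
    rwa [map_add, map_add, hx, zero_add] at hxy
  let t' := (t.image g).filter (· ≠ 0)
  let e := t'.equivFin
  have hw : ∀ j, ∃ z ∈ M, (e.symm j : ι ⊕ κ → ℤ) = g z := fun j => by
    obtain ⟨h1, h2⟩ := Finset.mem_filter.1 (e.symm j).2
    obtain ⟨z, hz, h3⟩ := Finset.mem_image.1 h1
    exact ⟨z, ht ▸ AddSubmonoid.subset_closure hz, h3.symm⟩
  have hadd : ∀ j, ∀ x ∈ a +ᵥ range g, x + (e.symm j : ι ⊕ κ → ℤ) ∈ a +ᵥ range g := by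
    rintro j _ ⟨_, ⟨x, rfl⟩, rfl⟩
    obtain ⟨z, -, hz⟩ := hw j
    exact ⟨_, ⟨x + z, rfl⟩, by simp [hz, add_assoc]⟩
  refine ⟨t'.card, fun j => e.symm j, fun j => ⟨?_, ?_, ?_, hadd j⟩, fun s => ?_⟩
  · exact (Finset.mem_filter.1 (e.symm j).2).2
  · obtain ⟨z, hz, h⟩ := hw j
    change (e.symm j : ι ⊕ κ → ℤ) ∘ Sum.inl = 0
    rw [h]
    exact hz
  · have := sub_mem_directions (hadd j x₀ hx₀) hx₀
    rwa [add_sub_cancel_left] at this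
  · -- By Dickson's lemma, the fibre has finitely many minimal elements in the coordinates `ℕ ^ n`.
    let Q : (Fin n → ℕ) → Prop := fun x => p (a + g x) = s
    refine ⟨(fun x => a + g x) '' {x | Minimal Q x},
      (WellQuasiOrderedLE.finite_of_isAntichain (setOfPred_minimal_antichain Q)).image _, ?_, ?_⟩
    · rintro _ ⟨x, hx, rfl⟩
      exact ⟨⟨_, ⟨x, rfl⟩, rfl⟩, hx.prop⟩
    · rintro _ ⟨_, ⟨x, rfl⟩, rfl⟩ hxs
      obtain ⟨μ, hμx, hμ⟩ := exists_minimal_le_of_wellFoundedLT Q x hxs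
      obtain ⟨z, rfl⟩ := le_iff_exists_add.1 hμx
      have hz : z ∈ M := by
        have h1 : p (a + g μ) = s := hμ.prop
        have h2 : p (a + g (μ + z)) = s := hxs
        rw [map_add g, ← add_assoc, map_add p, h1] at h2
        exact add_eq_left.1 h2
      have hzc : g z ∈ AddSubmonoid.closure (t' : Set (ι ⊕ κ → ℤ)) := by
        rw [← ht] at hz
        clear hxs hμx
        induction hz using AddSubmonoid.closure_induction with
        | mem z hz =>
          by_cases h0 : g z = 0
          · rw [h0]
            exact zero_mem _
          · refine AddSubmonoid.subset_closure ?_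
            simp only [t', Finset.coe_filter, Finset.mem_image, mem_ofPred_eq]
            exact ⟨⟨z, hz, rfl⟩, h0⟩
        | zero => rw [map_zero]; exact zero_mem _
        | add y z _ _ hy hz => rw [map_add]; exact add_mem hy hz
      obtain ⟨k, -, hk⟩ := AddSubmonoid.mem_closure_finset.1 hzc
      refine ⟨_, ⟨μ, hμ, rfl⟩, fun j => k (e.symm j), ?_⟩
      rw [← Finset.sum_coe_sort, ← e.symm.sum_comp] at hk
      rw [hk]
      simp [add_assoc]

variable {q : ℝ} (𝒢 : GrowthClass q)

/-- The value at `x` of the recurrence operator along the direction `w`. -/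
theorem recOp_line_apply {V : Type*} [AddCommMonoid V] (s : Multiset ℤ) (F : V → ℝ) (x w : V)
    (k : ℕ) : recOp q s (fun i => F (x + i • w)) k =
      (rootPoly q s).sum fun i c => (c : ℝ) * F (x + k • w + i • w) := by
  rw [recOp, aeval_seqShift_apply]
  simp only [add_smul, add_assoc]

/-- If `F` satisfies along each direction `w j` the recurrence of a growth class, then `F`
satisfies the growth condition on the monoid generated by the directions. -/
theorem GrowthClass.mem_of_directions {V : Type*} [AddCommMonoid V] {F : V → ℝ} {X : Set V} {r : ℕ}
    {w : Fin r → V} (hX : ∀ j, ∀ x ∈ X, x + w j ∈ X) {D : Fin r → ℕ}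
    (hrec : ∀ j, ∀ x ∈ X, recOp q (𝒢.roots (D j)) (fun k => F (x + k • w j)) 0 = 0)
    {x : V} (hx : x ∈ X) : 𝒢.Mem fun k : Fin r → ℕ => F (x + ∑ j, k j • w j) := by
  induction r generalizing x with
  | zero => exact 𝒢.mem_of_finite _
  | succ r ih =>
    have hXk : ∀ j (i : ℕ), ∀ x ∈ X, x + i • w j ∈ X := fun j i x hx => by
      induction i with
      | zero => simpa
      | succ i ih => rw [succ_nsmul, ← add_assoc]; exact hX j _ ih
    have hXs : ∀ (k : Fin r → ℕ) (x : V), x ∈ X → x + ∑ j, k j • w j.succ ∈ X := fun k => by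
      have : ∀ (T : Finset (Fin r)) (x : V), x ∈ X → x + ∑ j ∈ T, k j • w j.succ ∈ X := fun T => by
        induction T using Finset.induction with
        | empty => simp
        | insert j T hj ih =>
          intro x hx
          rw [Finset.sum_insert hj, ← add_assoc]
          exact ih _ (hXk _ _ _ hx)
      exact this Finset.univ
    have h1 := 𝒢.mem_of_recOp (D := D 0)
      (h := fun (k : Fin r → ℕ) i => F (x + ∑ j, k j • w j.succ + i • w 0)) (fun k => by
        funext i
        rw [recOp_line_apply]
        have h2 := hrec 0 _ (hXk 0 i _ (hXs k x hx))
        rw [recOp_line_apply] at h2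
        simpa using h2) (fun i => by
        have h2 := ih (w := fun j => w j.succ) (fun j => hX j.succ) (fun j => hrec j.succ)
          (hXk 0 i x hx)
        simpa only [add_right_comm] using h2)
    have h2 := 𝒢.comp (fun k : Fin (r + 1) → ℕ => (k 0, Fin.tail k)) (fun k k' h => by
      rw [Prod.mk.injEq] at h
      rw [← Fin.cons_self_tail k, ← Fin.cons_self_tail k', h.1, h.2]) h1
    convert! h2 using 2 with k
    simp only [Function.comp_apply, Fin.sum_univ_succ, Fin.tail]
    rw [add_assoc, add_comm (∑ j : Fin r, k j.succ • w j.succ)]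

variable {ι : Type} [Fintype ι] {S : Set (ι → ℤ)}

/-- The translation of `S × ℤ^m` by a multiple of a vertical vector. -/
def verticalShift {m : ℕ} {w : ι ⊕ Fin m → ℤ} (hw : w ∘ Sum.inl = 0) (i : ℕ) (x : prodInt S m) :
    prodInt S m :=
  ⟨(x : ι ⊕ Fin m → ℤ) + i • w, by
    have h : ∀ j, w (Sum.inl j) = 0 := congrFun hw
    have hx : (fun j => (x : ι ⊕ Fin m → ℤ) (Sum.inl j)) ∈ S := x.2
    simpa [prodInt, h] using hx⟩

/-- The loci of the growth conditions are zero loci: on each piece, the condition says that the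
recurrence operators along the generators of the vertical monoid annihilate `f` identically. -/
theorem isZeroLocus_growth (hq : q ≠ 0) (hS : IsSemilinearSet S) {m : ℕ}
    {f : prodInt S m → coeffRing q} (hf : f ∈ constructible q (prodInt S m)) :
    IsZeroLocus q {s : S | 𝒢.Mem fun y : Fin m → ℤ => (f (pt s y) : ℝ)} := by
  classical
  have hSm := isSemilinearSet_prodInt hS m
  obtain ⟨𝓛, hfin, hcover, h𝓛⟩ := exists_properLinear_pieces hq hSm hf
  have : Finite 𝓛 := hfin
  choose r w hw hfib using fun L : 𝓛 => (h𝓛 L L.2).1.isLinearSet.exists_fibre_monoid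
  choose D hD using fun (L : 𝓛) (j : Fin (r L)) => (h𝓛 L L.2).2 (w L j) (hw L j).2.2.1
  let P : ∀ L : 𝓛, Fin (r L) → Polynomial (coeffRing q) := fun L j =>
    rootPoly q (𝒢.roots (D L j))
  let g : ∀ L : 𝓛, Fin (r L) → prodInt S m → coeffRing q := fun L j =>
    (fun x : prodInt S m => if (x : ι ⊕ Fin m → ℤ) ∈ L.1 then (1 : coeffRing q) else 0) *
      ∑ i ∈ (P L j).support, algebraMap (coeffRing q) (prodInt S m → coeffRing q) ((P L j).coeff i) *
        (f ∘ verticalShift (hw L j).2.1 i)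
  have hg : ∀ L j, g L j ∈ constructible q (prodInt S m) := fun L j =>
    mul_mem (indicator_mem_constructible hSm (h𝓛 L L.2).1.isLinearSet.isSemilinearSet)
      (sum_mem fun i _ => mul_mem ((constructible q _).algebraMap_mem _)
        (constructible_comp hf (isPresburgerMap_of_reindex hSm id (i • w L j) fun x => rfl)))
  have hgx : ∀ L j (x : prodInt S m), (x : ι ⊕ Fin m → ℤ) ∈ L.1 → (g L j x = 0 ↔
      recOp q (𝒢.roots (D L j)) (fun k => extendZero f ((x : ι ⊕ Fin m → ℤ) + k • w L j)) 0 = 0) := by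
    intro L j x hx
    have h1 : g L j x = ∑ i ∈ (P L j).support, (P L j).coeff i *
        f (verticalShift (hw L j).2.1 i x) := by
      simp [g, hx]
    rw [recOp_line_apply, h1, Polynomial.sum_def, ← Subtype.coe_inj]
    push_cast
    have h2 : ∀ i, extendZero f ((x : ι ⊕ Fin m → ℤ) + 0 • w L j + i • w L j) =
        f (verticalShift (hw L j).2.1 i x) := fun i => by
      rw [zero_smul, add_zero]
      exact extendZero_apply f (verticalShift (hw L j).2.1 i x).2
    simp only [h2]
    rfl
  have key : IsZeroLocus q (⋂ L : 𝓛, ⋂ j : Fin (r L), ivaLocus (g L j)) :=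
    .iInter fun L => .iInter fun j => isZeroLocus_ivaLocus hq hS (hg L j)
  convert! key using 1
  ext s
  simp only [mem_iInter, ivaLocus, mem_ofPred_eq]
  have hpt : ∀ x : ι ⊕ Fin m → ℤ, x ∘ Sum.inl = s → (pt s (x ∘ Sum.inr) : ι ⊕ Fin m → ℤ) = x := by
    rintro x hx
    funext i
    rcases i with i | i
    · simp [pt, ← hx]
    · simp [pt]
  have hF : ∀ x : ι ⊕ Fin m → ℤ, x ∘ Sum.inl = s →
      (f (pt s (x ∘ Sum.inr)) : ℝ) = extendZero f x := fun x hx => by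
    conv_rhs => rw [← hpt x hx]
    exact (extendZero_apply f (pt s (x ∘ Sum.inr)).2).symm
  constructor
  · intro hs L j y
    by_cases hx : (pt s y : ι ⊕ Fin m → ℤ) ∈ L.1
    · rw [hgx L j _ hx]
      obtain ⟨hw0, hwl, -, hadd⟩ := hw L j
      obtain ⟨u, hu, hux⟩ := hD L j _ hx
      have hmem : ∀ k : ℕ, (pt s y : ι ⊕ Fin m → ℤ) + k • w L j ∈ L.1 := fun k => by
        induction k with
        | zero => simpa
        | succ k ih => rw [succ_nsmul, ← add_assoc]; exact hadd _ ih
      have hfu : (fun k : ℕ => extendZero f ((pt s y : ι ⊕ Fin m → ℤ) + k • w L j)) = u :=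
        funext fun k => hux k (hmem k)
      have hw0' : w L j ∘ Sum.inr ≠ 0 := fun h => hw0 <| by
        funext i
        rcases i with i | i
        · exact congrFun hwl i
        · exact congrFun h i
      have hinj : Function.Injective fun k : ℕ => y + k • (w L j ∘ Sum.inr) := fun k k' h => by
        have h1 := add_left_cancel h
        obtain ⟨i, hi⟩ := Function.ne_iff.1 hw0'
        have h2 := congrFun h1 i
        simp only [Pi.smul_apply, Int.nsmul_eq_mul] at h2
        exact_mod_cast mul_right_cancel₀ hi h2
      have hmemu := 𝒢.comp _ hinj hs
      have hcomp : ((fun y : Fin m → ℤ => (f (pt s y) : ℝ)) ∘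
          fun k : ℕ => y + k • (w L j ∘ Sum.inr)) = u := by
        rw [← hfu]
        funext k
        rw [← hF _ (by
          funext i
          have : w L j (Sum.inl i) = 0 := congrFun hwl i
          simp [pt, this])]
        rfl
      rw [hcomp] at hmemu
      rw [hfu, 𝒢.recOp_eq_zero hu hmemu]
      rfl
    · simp [g, hx]
  · intro h
    choose T hT hTL hTx using fun L : 𝓛 => hfib L s
    have : ∀ L, Finite (T L) := fun L => hT L
    refine 𝒢.of_cover (J := Σ L : 𝓛, T L) (K := fun p => Fin (r p.1) → ℕ)
      (fun p k => ((p.2 : ι ⊕ Fin m → ℤ) + ∑ j, k j • w p.1 j) ∘ Sum.inr) ?_ ?_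
    · intro y
      obtain ⟨L, hL, hy⟩ := hcover.subset (pt s y).2
      obtain ⟨μ, hμ, k, hk⟩ := hTx ⟨L, hL⟩ _ hy (by simp [pt])
      refine ⟨⟨⟨L, hL⟩, ⟨μ, hμ⟩⟩, k, ?_⟩
      simp only
      rw [← hk]
      rfl
    · rintro ⟨L, μ, hμ⟩
      obtain ⟨hμL, hμs⟩ := hTL L μ hμ
      have h1 := 𝒢.mem_of_directions (F := extendZero f) (X := {x ∈ L.1 | x ∘ Sum.inl = s})
        (w := w L) (D := D L) (fun j x hx => ⟨(hw L j).2.2.2 x hx.1, by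
          rw [← hx.2]
          funext i
          have : w L j (Sum.inl i) = 0 := congrFun (hw L j).2.1 i
          simp [this]⟩) (fun j x hx => by
          have h2 := h L j (x ∘ Sum.inr)
          rw [hgx L j _ (by rw [hpt x hx.2]; exact hx.1)] at h2
          rwa [hpt x hx.2] at h2) (x := μ) ⟨hμL, hμs⟩
      convert! h1 using 2 with k
      refine hF _ ?_
      rw [← hμs]
      funext i
      have : ∀ j, w L j (Sum.inl i) = 0 := fun j => congrFun (hw L j).2.1 i
      simp [Finset.sum_apply, this]

end Loci

/-! ### Comparison of the loci -/

section Comparison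

variable {ι : Type} {q : ℝ} {S : Set (ι → ℤ)} {m : ℕ}

theorem mem_intLocus_iff {f : prodInt S m → coeffRing q} {s : S} :
    s ∈ intLocus f ↔ SummableFamily fun y : Fin m → ℤ => (f (pt s y) : ℝ) := by
  simp only [intLocus, mem_ofPred_eq, integrable_count_iff, Real.norm_eq_abs, SummableFamily]

theorem mem_bddLocus_iff {f : prodInt S m → coeffRing q} {s : S} :
    s ∈ bddLocus f ↔ BoundedFamily fun y : Fin m → ℤ => (f (pt s y) : ℝ) := by
  simp [bddLocus, isBounded_iff_forall_norm_le, BoundedFamily]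

theorem SummableFamily.boundedFamily {I : Type} {f : I → ℝ} (hf : SummableFamily f) :
    BoundedFamily f :=
  ⟨∑' i, |f i|, fun i => hf.le_tsum i fun _ _ => abs_nonneg _⟩

variable [Fintype ι]

theorem isZeroLocus_intLocus (hq : 1 < q) (hS : IsSemilinearSet S)
    {f : prodInt S m → coeffRing q} (hf : f ∈ constructible q (prodInt S m)) :
    IsZeroLocus q (intLocus f) := by
  convert! isZeroLocus_growth (summableClass hq) (by linarith) hS hf using 1
  ext s
  exact mem_intLocus_iff

theorem isZeroLocus_bddLocus (hq : 1 < q) (hS : IsSemilinearSet S)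
    {f : prodInt S m → coeffRing q} (hf : f ∈ constructible q (prodInt S m)) :
    IsZeroLocus q (bddLocus f) := by
  convert! isZeroLocus_growth (boundedClass hq) (by linarith) hS hf using 1
  ext s
  exact mem_bddLocus_iff

/-- The zero locus of `h` is the locus of integrability, of boundedness and of identical vanishing
of the function `(s, y) ↦ h s * y`. -/
theorem exists_loci_eq_zeroLocus (hS : IsSemilinearSet S) {h : S → coeffRing q}
    (hh : h ∈ constructible q S) : ∃ f ∈ constructible q (prodInt S 1),
      zeroLocus h = intLocus f ∧ zeroLocus h = bddLocus f ∧ zeroLocus h = ivaLocus f := by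
  have hS1 := isSemilinearSet_prodInt hS 1
  let φ : prodInt S 1 → S := fun z => ⟨(z : ι ⊕ Fin 1 → ℤ) ∘ Sum.inl, z.2⟩
  have hφ : IsPresburgerMap φ := isPresburgerMap_of_reindex hS1 Sum.inl 0 fun z => by simp [φ]
  let f : prodInt S 1 → coeffRing q :=
    (h ∘ φ) * fun z : prodInt S 1 => (((z : ι ⊕ Fin 1 → ℤ) (Sum.inr 0) : ℤ) : coeffRing q)
  have hf : ∀ s y, f (pt s y) = h s * (y 0 : ℤ) := fun s y => rfl
  have hzero : ∀ s, h s = 0 → (fun y : Fin 1 → ℤ => (f (pt s y) : ℝ)) = fun _ => 0 :=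
    fun s hs => by
      funext y
      simp [hf, hs]
  have hne : ∀ s, BoundedFamily (fun y : Fin 1 → ℤ => (f (pt s y) : ℝ)) → h s = 0 := by
    rintro s ⟨B, hB⟩
    by_contra hs
    have hs' : 0 < |(h s : ℝ)| := abs_pos.2 (by exact_mod_cast hs)
    obtain ⟨k, hk⟩ := exists_nat_gt (B / |(h s : ℝ)|)
    rw [div_lt_iff₀' hs'] at hk
    have := hB fun _ => k
    simp only [hf, Subring.coe_mul, Int.cast_natCast, Subring.coe_natCast, abs_mul,
      Nat.abs_cast] at this
    linarith
  refine ⟨f, mul_mem (constructible_comp hh hφ)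
    (intCast_mem_constructible (isPresburgerFun_apply hS1 _)), ?_, ?_, ?_⟩
  · ext s
    rw [mem_intLocus_iff]
    refine ⟨fun hs => ?_, fun hs => hne s hs.boundedFamily⟩
    rw [hzero s hs]
    simp [SummableFamily, summable_zero]
  · ext s
    rw [mem_bddLocus_iff]
    refine ⟨fun hs => ?_, hne s⟩
    rw [hzero s hs]
    exact ⟨0, fun _ => by simp⟩
  · ext s
    simp only [zeroLocus, ivaLocus, mem_ofPred_eq, hf]
    refine ⟨fun hs y => by simp [hs], fun hs => ?_⟩
    simpa using hs fun _ => 1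

end Comparison

end

open PresburgerLoci in
theorem mainTheorem12 (q : ℝ) (hq : 1 < q) (n : ℕ) (S : Set (Fin n → ℤ))
    (hS : IsPresburgerSet S) :
    (∀ (m : ℕ) (f : prodInt S m → coeffRing q), f ∈ constructible q (prodInt S m) →
      ∃ h₁ ∈ constructible q S, ∃ h₂ ∈ constructible q S, ∃ h₃ ∈ constructible q S,
        intLocus f = zeroLocus h₁ ∧ bddLocus f = zeroLocus h₂ ∧ ivaLocus f = zeroLocus h₃) ∧
    (∀ h ∈ constructible q S, ∃ f ∈ constructible q (prodInt S 1),
      zeroLocus h = intLocus f ∧ zeroLocus h = bddLocus f ∧ zeroLocus h = ivaLocus f) ∧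
    ({Z : Set S | ∃ m : ℕ, ∃ f ∈ constructible q (prodInt S m), Z = intLocus f} =
      {Z : Set S | ∃ h ∈ constructible q S, Z = zeroLocus h}) ∧
    ({Z : Set S | ∃ m : ℕ, ∃ f ∈ constructible q (prodInt S m), Z = bddLocus f} =
      {Z : Set S | ∃ h ∈ constructible q S, Z = zeroLocus h}) ∧
    ({Z : Set S | ∃ m : ℕ, ∃ f ∈ constructible q (prodInt S m), Z = ivaLocus f} =
      {Z : Set S | ∃ h ∈ constructible q S, Z = zeroLocus h}) := by
  have hS' := hS.isSemilinearSet
  have h2 := fun h hh => exists_loci_eq_zeroLocus (q := q) hS' (h := h) hh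
  refine ⟨fun m f hf => ?_, h2, ?_, ?_, ?_⟩
  · obtain ⟨h₁, hh₁, e₁⟩ := isZeroLocus_intLocus hq hS' hf
    obtain ⟨h₂, hh₂, e₂⟩ := isZeroLocus_bddLocus hq hS' hf
    obtain ⟨h₃, hh₃, e₃⟩ := isZeroLocus_ivaLocus (by linarith) hS' hf
    exact ⟨h₁, hh₁, h₂, hh₂, h₃, hh₃, e₁, e₂, e₃⟩
  · ext Z
    constructor
    · rintro ⟨m, f, hf, rfl⟩
      exact isZeroLocus_intLocus hq hS' hf
    · rintro ⟨h, hh, rfl⟩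
      obtain ⟨f, hf, e, -, -⟩ := h2 h hh
      exact ⟨1, f, hf, e⟩
  · ext Z
    constructor
    · rintro ⟨m, f, hf, rfl⟩
      exact isZeroLocus_bddLocus hq hS' hf
    · rintro ⟨h, hh, rfl⟩
      obtain ⟨f, hf, -, e, -⟩ := h2 h hh
      exact ⟨1, f, hf, e⟩
  · ext Z
    constructor
    · rintro ⟨m, f, hf, rfl⟩
      exact isZeroLocus_ivaLocus (by linarith) hS' hf
    · rintro ⟨h, hh, rfl⟩
      obtain ⟨f, hf, -, -, e⟩ := h2 h hh
      exact ⟨1, f, hf, e⟩
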